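/- Monoids are commutative with an absorbing element $0$. A monoid scheme is a topological space $X$ with a sheaf $\mathcal{O}_X$ of monoids that is locally isomorphic to the prime spectrum $\operatorname{Spec} M$ of a monoid $M$ (with the Zariski topology and the structure sheaf of functions $\mathfrak p\mapsto s(\mathfrak p)\in M_{\mathfrak p}$ that are locally given by fractions); it is irreducible if its underlying space is irreducible (in particular non-empty). An invertible sheaf on $X$ is a sheaf of $\mathcal{O}_X$-sets (sets of sections over $U$ carrying an action of the monoid $\mathcal O_X(U)$, compatibly with restriction) that is locally isomorphic to $\mathcal{O}_X$, and $\operatorname{Pic}(X)$ is the group of isomorphism classes of invertible sheaves, with multiplication induced by the tensor product $\mathcal L_1\otimes_{\mathcal{O}_X}\mathcal L_2$, the sheafification of $U\mapsto \mathcal L_1(U)\otimes_{\mathcal O_X(U)}\mathcal L_2(U)$. Let $\mathcal{O}_X^\times$ be the sheaf of abelian groups of units of $\mathcal{O}_X$. **Proposition.** Let $X$ be an irreducible monoid scheme, let $K$ be a semifield (for example an idempotent semifield or a field), and let $\mathcal{K}^\times$ be the constant sheaf on $X$ associated with the abelian group $K^\times$. Then there is an isomorphism of groups $$\operatorname{Pic}(X)\;\cong\;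 H^1\bigl(X,\ \mathcal{K}^\times\times\mathcal{O}_X^\times\bigr),$$ where $H^1$ is sheaf cohomology of sheaves of abelian groups. -/

import Mathlib

open CategoryTheory TopologicalSpace Opposite

universe u

noncomputable section

/-! ## Monoidal spaces

Throughout, a "monoid" is a commutative monoid with an absorbing element `0`, that is, a
`CommMonoidWithZero` (the case `0 = 1` is allowed). -/

/-- A monoidal space: a topological space with a sheaf of (commutative, pointed) monoids. The sheaf
is given by its underlying sheaf of sets, monoid structures on all sets of sections, and the
condition that restriction maps are homomorphisms. -/
structure MonoidalSpace where
  /-- the underlying space -/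
  space : TopCat.{u}
  /-- the underlying sheaf of sets of the structure sheaf -/
  sheaf : TopCat.Sheaf (Type u) space
  /-- the monoid structure on sections -/
  [monoid : ∀ U : Opens space, CommMonoidWithZero (sheaf.obj.obj (op U))]
  map_one : ∀ {U V : Opens space} (i : V ⟶ U), sheaf.obj.map i.op 1 = 1
  map_zero : ∀ {U V : Opens space} (i : V ⟶ U), sheaf.obj.map i.op 0 = 0
  map_mul : ∀ {U V : Opens space} (i : V ⟶ U) (a b : sheaf.obj.obj (op U)),
    sheaf.obj.map i.op (a * b) = sheaf.obj.map i.op a * sheaf.obj.map i.op b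

namespace MonoidalSpace

attribute [instance] MonoidalSpace.monoid

/-- The monoid `𝒪_X(U)` of sections of the structure sheaf. -/
abbrev Sec (X : MonoidalSpace.{u}) (U : Opens X.space) : Type u := X.sheaf.obj.obj (op U)

/-- The restriction homomorphism `𝒪_X(U) → 𝒪_X(V)` for `V ⊆ U`. -/
def res (X : MonoidalSpace.{u}) {U V : Opens X.space} (i : V ⟶ U) : X.Sec U →*₀ X.Sec V where
  toFun := X.sheaf.obj.map i.op
  map_one' := X.map_one i
  map_zero' := X.map_zero i
  map_mul' := X.map_mul i

lemma res_apply (X : MonoidalSpace.{u}) {U V : Opens X.space} (i : V ⟶ U) (a : X.Sec U) :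
    X.res i a = X.sheaf.obj.map i.op a := rfl

lemma res_id (X : MonoidalSpace.{u}) {U : Opens X.space} (i : U ⟶ U) (a : X.Sec U) :
    X.res i a = a := by
  obtain rfl : i = 𝟙 U := Subsingleton.elim _ _
  simp [res_apply]

lemma res_res (X : MonoidalSpace.{u}) {U V W : Opens X.space} (i : V ⟶ U) (j : W ⟶ V)
    (k : W ⟶ U) (a : X.Sec U) : X.res j (X.res i a) = X.res k a := by
  obtain rfl : k = j ≫ i := Subsingleton.elim _ _
  simp [res_apply]

/-- The restriction of a monoidal space to an open subset `U`:
its sections over an open subset `V` of `U` are `𝒪_X(V)`. -/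
def restrict (X : MonoidalSpace.{u}) (U : Opens X.space) : MonoidalSpace.{u} where
  space := TopCat.of U
  sheaf := ⟨U.isOpenEmbedding.functor.op ⋙ X.sheaf.obj,
    TopCat.Presheaf.isSheaf_of_isOpenEmbedding U.isOpenEmbedding X.sheaf.property⟩
  monoid := fun V => inferInstanceAs (CommMonoidWithZero (X.Sec (U.isOpenEmbedding.functor.obj V)))
  map_one := fun i => X.map_one (U.isOpenEmbedding.functor.map i)
  map_zero := fun i => X.map_zero (U.isOpenEmbedding.functor.map i)
  map_mul := fun i => X.map_mul (U.isOpenEmbedding.functor.map i)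

/-- The preimage of an open set under a homeomorphism, as an open set. -/
abbrev preimage {X Y : MonoidalSpace.{u}} (φ : X.space ≃ₜ Y.space) (V : Opens Y.space) :
    Opens X.space :=
  V.comap ⟨φ, φ.continuous⟩

/-- An isomorphism of monoidal spaces: a homeomorphism `φ : X → Y` with an isomorphism
`𝒪_Y ≅ φ_* 𝒪_X` of sheaves of monoids. (Such a pair is automatically local, and isomorphisms of
monoids automatically preserve `0`.) -/
structure Iso (X Y : MonoidalSpace.{u}) where
  /-- the homeomorphism of underlying spaces -/
  homeo : X.space ≃ₜ Y.space
  /-- the isomorphisms on sections -/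
  equiv : ∀ V : Opens Y.space, Y.Sec V ≃* X.Sec (preimage homeo V)
  naturality : ∀ {V W : Opens Y.space} (i : W ⟶ V) (j : preimage homeo W ⟶ preimage homeo V)
    (a : Y.Sec V), equiv W (Y.res i a) = X.res j (equiv V a)

end MonoidalSpace

/-! ## The prime spectrum of a monoid -/

/-- A prime ideal of a monoid `M`: a subset containing `0`, absorbing multiplication by `M`,
and with complement a submonoid. -/
@[ext]
structure MonoidPrime (M : Type u) [CommMonoidWithZero M] where
  /-- the underlying set of the prime ideal -/
  carrier : Set M
  zero_mem : (0 : M) ∈ carrier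
  mul_mem : ∀ (a : M) {b : M}, b ∈ carrier → a * b ∈ carrier
  one_notMem : (1 : M) ∉ carrier
  mem_or_mem : ∀ {a b : M}, a * b ∈ carrier → a ∈ carrier ∨ b ∈ carrier

namespace MonoidPrime

variable {M : Type u} [CommMonoidWithZero M]

/-- The complement of a prime ideal, as a submonoid. -/
def compl (p : MonoidPrime M) : Submonoid M where
  carrier := p.carrierᶜ
  one_mem' := p.one_notMem
  mul_mem' := fun ha hb h => (p.mem_or_mem h).elim ha hb

/-- The basic open set `D(f)`, the set of primes not containing `f`. -/
def basicOpen (f : M) : Set (MonoidPrime M) := {p | f ∉ p.carrier}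

/-- The Zariski topology on the prime spectrum. -/
instance : TopologicalSpace (MonoidPrime M) :=
  TopologicalSpace.generateFrom (Set.range basicOpen)

/-- The sets `D(f)` form a basis of the Zariski topology, not only a subbasis. -/
theorem isTopologicalBasis_basicOpen :
    TopologicalSpace.IsTopologicalBasis (Set.range (basicOpen (M := M))) where
  exists_subset_inter := by
    rintro _ ⟨f, rfl⟩ _ ⟨g, rfl⟩ p ⟨hf, hg⟩
    refine ⟨_, ⟨f * g, rfl⟩, fun h => (p.mem_or_mem h).elim hf hg, fun q hq => ⟨fun h => hq ?_,
      fun h => hq (q.mul_mem f h)⟩⟩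
    rw [mul_comm]
    exact q.mul_mem g h
  sUnion_eq := by
    refine Set.eq_univ_of_forall fun p => ⟨_, ⟨1, rfl⟩, p.one_notMem⟩
  eq_generateFrom := rfl

variable (M) in
/-- The prime spectrum as an object of `TopCat`. -/
def top : TopCat.{u} := TopCat.of (MonoidPrime M)

/-- The localization `M_𝔭` of a monoid at a prime ideal. -/
abbrev LocalizationAt (p : top M) : Type u := Localization (MonoidPrime.compl (M := M) p)

variable (M) in
/-- The predicate, for a function `s` with `s(𝔭) ∈ M_𝔭`, of being given on all its domain by one
fraction `a / f` with `a, f ∈ M`. -/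
def isFraction : TopCat.PrelocalPredicate (LocalizationAt (M := M)) where
  pred {U} s := ∃ a f : M, ∀ p : U, ∃ h : f ∈ MonoidPrime.compl (M := M) p.1,
    s p = Localization.mk a ⟨f, h⟩
  res := by
    rintro U V i s ⟨a, f, h⟩
    exact ⟨a, f, fun p => h (i p)⟩

variable (M) in
/-- The predicate of being locally given by fractions. -/
def isLocallyFraction : TopCat.LocalPredicate (LocalizationAt (M := M)) :=
  (isFraction M).sheafify

variable (M) in
/-- The sheaf of sets underlying the structure sheaf of `Spec M`: functions `s` on open subsets with
`s(𝔭) ∈ M_𝔭` which are locally given by fractions. -/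
def structureSheaf : TopCat.Sheaf (Type u) (top M) := TopCat.subsheafToTypes (isLocallyFraction M)

theorem isLocallyFraction_const {U : Opens (top M)} (a : M) :
    (isLocallyFraction M).pred (fun p : U => Localization.mk a (1 : MonoidPrime.compl p.1)) :=
  fun p => ⟨U, p.2, 𝟙 _, a, 1, fun q => ⟨(MonoidPrime.compl q.1).one_mem, rfl⟩⟩

theorem isLocallyFraction_mul {U : Opens (top M)} {s t : ∀ p : U, LocalizationAt p.1}
    (hs : (isLocallyFraction M).pred s) (ht : (isLocallyFraction M).pred t) :
    (isLocallyFraction M).pred (fun p => s p * t p) := by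
  intro p
  obtain ⟨V, hV, i, a, f, hf⟩ := hs p
  obtain ⟨W, hW, j, b, g, hg⟩ := ht p
  refine ⟨V ⊓ W, ⟨hV, hW⟩, Opens.infLELeft _ _ ≫ i, a * b, f * g, fun q => ?_⟩
  obtain ⟨hf1, hf2⟩ := hf ⟨q.1, q.2.1⟩
  obtain ⟨hg1, hg2⟩ := hg ⟨q.1, q.2.2⟩
  exact ⟨(MonoidPrime.compl q.1).mul_mem hf1 hg1,
    congr($hf2 * $hg2).trans (Localization.mk_mul ..)⟩

/-- Sections of the structure sheaf are multiplied pointwise. -/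
instance (U : Opens (top M)) : CommMonoidWithZero ((structureSheaf M).obj.obj (op U)) where
  mul s t := ⟨fun p => s.1 p * t.1 p, isLocallyFraction_mul s.2 t.2⟩
  one := ⟨fun _ => 1, by
    have := isLocallyFraction_const (U := U) (1 : M)
    simp only [Localization.mk_one] at this
    exact this⟩
  zero := ⟨fun _ => 0, by
    have := isLocallyFraction_const (U := U) (0 : M)
    simp only [Localization.mk_zero] at this
    exact this⟩
  mul_assoc s t r := Subtype.ext (funext fun _ => mul_assoc _ _ _)
  mul_comm s t := Subtype.ext (funext fun _ => mul_comm _ _)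
  one_mul s := Subtype.ext (funext fun _ => one_mul _)
  mul_one s := Subtype.ext (funext fun _ => mul_one _)
  zero_mul s := Subtype.ext (funext fun _ => zero_mul _)
  mul_zero s := Subtype.ext (funext fun _ => mul_zero _)

end MonoidPrime

/-- The affine monoid scheme `Spec M`. -/
def MonoidSpec (M : Type u) [CommMonoidWithZero M] : MonoidalSpace.{u} where
  space := MonoidPrime.top M
  sheaf := MonoidPrime.structureSheaf M
  map_one := fun _ => rfl
  map_zero := fun _ => rfl
  map_mul := fun _ _ _ => rfl

/-- A monoid scheme: a monoidal space which is locally isomorphic to affine monoid schemes. -/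
structure MonoidScheme extends MonoidalSpace.{u} where
  local_affine : ∀ x : space, ∃ U : Opens space, x ∈ U ∧
    ∃ (M : Type u) (_ : CommMonoidWithZero M),
      Nonempty (MonoidalSpace.Iso (toMonoidalSpace.restrict U) (MonoidSpec M))

/-! ## Sheaves of `𝒪_X`-sets -/

/-- A presheaf of `𝒪_X`-sets: a presheaf of sets with an action of the monoid `𝒪_X(U)` on the
sections over `U`, compatible with restriction. -/
structure OSetPresheaf (X : MonoidalSpace.{u}) where
  /-- the underlying presheaf of sets -/
  presheaf : TopCat.Presheaf (Type u) X.space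
  /-- the action on sections -/
  [act : ∀ U : Opens X.space, MulAction (X.Sec U) (presheaf.obj (op U))]
  map_smul : ∀ {U V : Opens X.space} (i : V ⟶ U) (a : X.Sec U) (s : presheaf.obj (op U)),
    presheaf.map i.op (a • s) = X.res i a • presheaf.map i.op s

namespace OSetPresheaf

attribute [instance] OSetPresheaf.act

variable {X : MonoidalSpace.{u}}

/-- The set of sections over `U`. -/
abbrev Sec (A : OSetPresheaf X) (U : Opens X.space) : Type u := A.presheaf.obj (op U)

/-- The restriction map. -/
def res (A : OSetPresheaf X) {U V : Opens X.space} (i : V ⟶ U) (s : A.Sec U) : A.Sec V :=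
  A.presheaf.map i.op s

lemma res_smul (A : OSetPresheaf X) {U V : Opens X.space} (i : V ⟶ U) (a : X.Sec U)
    (s : A.Sec U) : A.res i (a • s) = X.res i a • A.res i s := A.map_smul i a s

lemma res_id (A : OSetPresheaf X) {U : Opens X.space} (i : U ⟶ U) (s : A.Sec U) :
    A.res i s = s := by
  obtain rfl : i = 𝟙 U := Subsingleton.elim _ _
  simp [res]

lemma res_res (A : OSetPresheaf X) {U V W : Opens X.space} (i : V ⟶ U) (j : W ⟶ V)
    (k : W ⟶ U) (s : A.Sec U) : A.res j (A.res i s) = A.res k s := by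
  obtain rfl : k = j ≫ i := Subsingleton.elim _ _
  simp [res]

variable (X) in
/-- The structure sheaf as a presheaf of `𝒪_X`-sets, acting on itself by multiplication. -/
def structureOSet : OSetPresheaf X where
  presheaf := X.sheaf.obj
  act := fun U => inferInstanceAs (MulAction (X.Sec U) (X.Sec U))
  map_smul := fun i a s => X.map_mul i a s

/-- An isomorphism `A|_U ≅ B|_U` of presheaves of `𝒪_U`-sets on the open subset `U`. -/
@[ext]
structure IsoOn (A B : OSetPresheaf X) (U : Opens X.space) where
  /-- the bijections on sections over open subsets of `U` -/
  equiv : ∀ V : Opens X.space, V ≤ U → A.Sec V ≃ B.Sec V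
  map_smul : ∀ (V : Opens X.space) (h : V ≤ U) (a : X.Sec V) (s : A.Sec V),
    equiv V h (a • s) = a • equiv V h s
  naturality : ∀ (V W : Opens X.space) (hV : V ≤ U) (hW : W ≤ U) (i : W ⟶ V) (s : A.Sec V),
    equiv W hW (A.res i s) = B.res i (equiv V hV s)

namespace IsoOn

variable {A B C : OSetPresheaf X} {U : Opens X.space}

/-- The identity. -/
def refl (A : OSetPresheaf X) (U : Opens X.space) : IsoOn A A U where
  equiv := fun _ _ => Equiv.refl _
  map_smul := fun _ _ _ _ => rfl
  naturality := fun _ _ _ _ _ _ => rfl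

/-- The inverse isomorphism. -/
def symm (e : IsoOn A B U) : IsoOn B A U where
  equiv := fun V h => (e.equiv V h).symm
  map_smul := fun V h a s => by
    rw [Equiv.symm_apply_eq, e.map_smul, Equiv.apply_symm_apply]
  naturality := fun V W hV hW i s => by
    rw [Equiv.symm_apply_eq, e.naturality V W hV hW, Equiv.apply_symm_apply]

/-- The composition of isomorphisms. -/
def trans (e : IsoOn A B U) (f : IsoOn B C U) : IsoOn A C U where
  equiv := fun V h => (e.equiv V h).trans (f.equiv V h)
  map_smul := fun V h a s => by
    simp only [Equiv.trans_apply, e.map_smul, f.map_smul]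
  naturality := fun V W hV hW i s => by
    simp only [Equiv.trans_apply, e.naturality V W hV hW, f.naturality V W hV hW]

end IsoOn

/-- A sheaf of `𝒪_X`-sets is invertible if it is locally isomorphic to `𝒪_X`. -/
structure IsInvertible (A : OSetPresheaf X) : Prop where
  isSheaf : A.presheaf.IsSheaf
  locally_trivial : ∀ x : X.space, ∃ U : Opens X.space, x ∈ U ∧
    Nonempty (IsoOn A (structureOSet X) U)

/-! ### The tensor product of presheaves -/

/-- The relation `(a s, t) ~ (s, a t)` on `A(U) × B(U)`. -/
inductive TensorRel (A B : OSetPresheaf X) (U : Opens X.space) :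
    A.Sec U × B.Sec U → A.Sec U × B.Sec U → Prop
  | smul (a : X.Sec U) (s : A.Sec U) (t : B.Sec U) : TensorRel A B U (a • s, t) (s, a • t)

/-- The tensor product `A(U) ⊗ B(U)` over `𝒪_X(U)`: the quotient of the product by the equivalence
relation generated by `(a s, t) ~ (s, a t)`. -/
def TensorSec (A B : OSetPresheaf X) (U : Opens X.space) : Type u := Quot (TensorRel A B U)

/-- The element `s ⊗ t`. -/
def tmul {A B : OSetPresheaf X} {U : Opens X.space} (s : A.Sec U) (t : B.Sec U) :
    TensorSec A B U := Quot.mk _ (s, t)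

lemma smul_tmul {A B : OSetPresheaf X} {U : Opens X.space} (a : X.Sec U) (s : A.Sec U)
    (t : B.Sec U) : tmul (a • s) t = tmul s (a • t) := Quot.sound (.smul a s t)

/-- The action `a (s ⊗ t) = (a s) ⊗ t`. -/
instance (A B : OSetPresheaf X) (U : Opens X.space) : MulAction (X.Sec U) (TensorSec A B U) where
  smul a := Quot.lift (fun p => tmul (a • p.1) p.2) (by
    rintro _ _ ⟨b, s, t⟩
    simp only [smul_tmul, smul_smul])
  one_smul := by
    rintro ⟨s, t⟩
    exact congrArg (tmul · t) (one_smul _ s)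
  mul_smul := by
    rintro a b ⟨s, t⟩
    exact congrArg (tmul · t) (mul_smul a b s)

lemma smul_tmul' {A B : OSetPresheaf X} {U : Opens X.space} (a : X.Sec U) (s : A.Sec U)
    (t : B.Sec U) : a • tmul s t = tmul (a • s) t := rfl

/-- The restriction map `s ⊗ t ↦ s|_V ⊗ t|_V`. -/
def tensorRes (A B : OSetPresheaf X) {U V : Opens X.space} (i : V ⟶ U) :
    TensorSec A B U → TensorSec A B V :=
  Quot.lift (fun p => tmul (A.res i p.1) (B.res i p.2)) (by
    rintro _ _ ⟨b, s, t⟩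
    simp only [res_smul, smul_tmul])

/-- The presheaf `U ↦ A(U) ⊗ B(U)`. -/
def tensorPresheaf (A B : OSetPresheaf X) : OSetPresheaf X where
  presheaf :=
    { obj := fun U => TensorSec A B U.unop
      map := fun i => ↾(tensorRes A B i.unop)
      map_id := fun U => by
        ext ⟨s, t⟩
        exact congrArg₂ tmul (A.res_id _ s) (B.res_id _ t)
      map_comp := fun i j => by
        ext ⟨s, t⟩
        exact (congrArg₂ tmul (A.res_res _ _ _ s) (B.res_res _ _ _ t)).symm }
  act := fun U => (inferInstance : MulAction (X.Sec U) (TensorSec A B U))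
  map_smul := by
    rintro U V i a ⟨s, t⟩
    exact congrArg (tmul · (B.res i t)) (A.res_smul i a s)

/-! ### Sheafification -/

lemma germ_smul_res (A : OSetPresheaf X) {U : Opens X.space} (a : X.Sec U) (x : X.space)
    (hx : x ∈ U) {V W : Opens X.space} (i : W ⟶ V) (hW : x ∈ W) (s : A.Sec V) :
    A.presheaf.germ (W ⊓ U) x ⟨hW, hx⟩
      (X.res (Opens.infLERight W U) a • A.res (Opens.infLELeft W U) (A.res i s)) =
    A.presheaf.germ (V ⊓ U) x ⟨i.le hW, hx⟩
      (X.res (Opens.infLERight V U) a • A.res (Opens.infLELeft V U) s) := by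
  refine TopCat.Presheaf.germ_ext _ (W ⊓ U) ⟨hW, hx⟩ (𝟙 _) (homOfLE (inf_le_inf_right U i.le)) ?_
  change A.res _ (_ • A.res _ (A.res i s)) = A.res _ (_ • A.res _ s)
  simp only [res_smul]
  rw [X.res_res _ _ (Opens.infLERight _ _), X.res_res _ _ (Opens.infLERight _ _),
    A.res_res _ _ (homOfLE (inf_le_left.trans i.le)),
    A.res_res _ _ (homOfLE (inf_le_left.trans i.le)),
    A.res_res _ _ (homOfLE (inf_le_left.trans i.le))]

/-- The cocone defining `stalkAct`. -/
def stalkActCocone (A : OSetPresheaf X) {U : Opens X.space} (a : X.Sec U) (x : X.space)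
    (hx : x ∈ U) : Limits.Cocone ((OpenNhds.inclusion x).op ⋙ A.presheaf) where
  pt := A.presheaf.stalk x
  ι :=
    { app := fun V => ↾(fun s => A.presheaf.germ (V.unop.1 ⊓ U) x ⟨V.unop.2, hx⟩
        (X.res (Opens.infLERight V.unop.1 U) a • A.res (Opens.infLELeft V.unop.1 U) s))
      naturality := fun V W i => by
        ext s
        exact A.germ_smul_res a x hx ((OpenNhds.inclusion x).map i.unop) W.unop.2 s }

/-- The action of a section `a` of `𝒪_X` over `U` on the stalk at a point `x` of `U`, sending the
germ of `s` to the germ of `a s`. -/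
def stalkAct (A : OSetPresheaf X) {U : Opens X.space} (a : X.Sec U) (x : X.space) (hx : x ∈ U) :
    A.presheaf.stalk x ⟶ A.presheaf.stalk x :=
  Limits.colimit.desc _ (A.stalkActCocone a x hx)

lemma stalkAct_germ (A : OSetPresheaf X) {U : Opens X.space} (a : X.Sec U) (x : X.space)
    (hx : x ∈ U) {V : Opens X.space} (i : V ⟶ U) (hV : x ∈ V) (s : A.Sec V) :
    A.stalkAct a x hx (A.presheaf.germ V x hV s) = A.presheaf.germ V x hV (X.res i a • s) := by
  have h : A.stalkAct a x hx (A.presheaf.germ V x hV s) =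
      A.presheaf.germ (V ⊓ U) x ⟨hV, hx⟩
        (X.res (Opens.infLERight _ _) a • A.res (Opens.infLELeft V U) s) :=
    Limits.colimit.ι_desc_apply (A.stalkActCocone a x hx) (op (⟨V, hV⟩ : OpenNhds x)) s
  rw [h]
  refine TopCat.Presheaf.germ_ext _ V hV (homOfLE (le_inf le_rfl i.le)) (𝟙 _) ?_
  change A.res _ (_ • A.res _ s) = A.res _ (_ • s)
  rw [res_smul, res_smul, X.res_res _ _ i, X.res_res _ _ i, A.res_res _ _ (𝟙 _)]

/-- The sheafification of a presheaf of `𝒪_X`-sets: the sheaf of functions into the stalks which are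
locally given by germs of sections, with the pointwise action of `𝒪_X`. -/
def sheafification (A : OSetPresheaf X) : OSetPresheaf X where
  presheaf := A.presheaf.sheafify.obj
  act := fun U =>
    { smul := fun a s => ⟨fun x => A.stalkAct a x.1 x.2 (s.1 x), fun x => by
        obtain ⟨V, hV, i, t, ht⟩ := s.2 x
        exact ⟨V, hV, i, X.res i a • t, fun y =>
          (congrArg _ (ht y)).trans (A.stalkAct_germ a _ _ i y.2 t)⟩⟩
      one_smul := fun s => Subtype.ext (funext fun x => by
        change A.stalkAct 1 x.1 x.2 (s.1 x) = s.1 x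
        obtain ⟨V, hV, i, t, ht⟩ := s.2 x
        rw [show s.1 x = _ from ht ⟨x, hV⟩, A.stalkAct_germ _ _ _ i, map_one, one_smul])
      mul_smul := fun a b s => Subtype.ext (funext fun x => by
        change A.stalkAct (a * b) x.1 x.2 (s.1 x) =
          A.stalkAct a x.1 x.2 (A.stalkAct b x.1 x.2 (s.1 x))
        obtain ⟨V, hV, i, t, ht⟩ := s.2 x
        rw [show s.1 x = _ from ht ⟨x, hV⟩, A.stalkAct_germ _ _ _ i, A.stalkAct_germ _ _ _ i,
          A.stalkAct_germ _ _ _ i, map_mul, mul_smul]) }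
  map_smul := fun {U V} i a s => Subtype.ext (funext fun x => by
    change A.stalkAct a x.1 (i.le x.2) (s.1 (i x)) = A.stalkAct (X.res i a) x.1 x.2 (s.1 (i x))
    obtain ⟨W, t, hW, ht⟩ : ∃ (W : Opens X.space) (t : A.Sec W) (hW : x.1 ∈ W),
        s.1 (i x) = A.presheaf.germ W x.1 hW t := by
      obtain ⟨W, hW, j, t, ht⟩ := s.2 (i x)
      exact ⟨W, t, hW, ht ⟨_, hW⟩⟩
    obtain ⟨W', t', j, hW', ht'⟩ : ∃ (W' : Opens X.space) (t' : A.Sec W') (_ : W' ⟶ V)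
        (hW' : x.1 ∈ W'), s.1 (i x) = A.presheaf.germ W' x.1 hW' t' :=
      ⟨W ⊓ V, A.res (Opens.infLELeft _ _) t, Opens.infLERight _ _, ⟨hW, x.2⟩,
        ht.trans (A.presheaf.germ_res_apply (Opens.infLELeft W V) _ _ t).symm⟩
    rw [ht', A.stalkAct_germ _ _ _ (j ≫ i), A.stalkAct_germ _ _ _ j, X.res_res])

/-- The tensor product `A ⊗ B` of sheaves of `𝒪_X`-sets: the sheafification of
`U ↦ A(U) ⊗ B(U)`. -/
def tensor (A B : OSetPresheaf X) : OSetPresheaf X := (tensorPresheaf A B).sheafification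

/-! ### Invertibility of tensor products -/

namespace IsoOn

variable {A B A' B' : OSetPresheaf X} {U : Opens X.space}

/-- Restriction of an isomorphism to a smaller open subset. -/
def restrict (e : IsoOn A B U) {V : Opens X.space} (h : V ≤ U) : IsoOn A B V where
  equiv := fun W hW => e.equiv W (hW.trans h)
  map_smul := fun W hW => e.map_smul W (hW.trans h)
  naturality := fun W W' hW hW' => e.naturality W W' (hW.trans h) (hW'.trans h)

/-- The tensor product of isomorphisms, on sections. -/
def tensorMap (e : IsoOn A A' U) (f : IsoOn B B' U) (V : Opens X.space) (h : V ≤ U) :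
    TensorSec A B V → TensorSec A' B' V :=
  Quot.lift (fun p => tmul (e.equiv V h p.1) (f.equiv V h p.2)) (by
    rintro _ _ ⟨b, s, t⟩
    simp only [e.map_smul, f.map_smul, smul_tmul])

/-- The tensor product of isomorphisms. -/
def tensorPresheaf (e : IsoOn A A' U) (f : IsoOn B B' U) :
    IsoOn (A.tensorPresheaf B) (A'.tensorPresheaf B') U where
  equiv := fun V h =>
    { toFun := e.tensorMap f V h
      invFun := e.symm.tensorMap f.symm V h
      left_inv := by
        rintro ⟨s, t⟩
        exact congrArg₂ tmul ((e.equiv V h).symm_apply_apply s) ((f.equiv V h).symm_apply_apply t)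
      right_inv := by
        rintro ⟨s, t⟩
        exact congrArg₂ tmul ((e.equiv V h).apply_symm_apply s)
          ((f.equiv V h).apply_symm_apply t) }
  map_smul := by
    rintro V h a ⟨s, t⟩
    exact congrArg (tmul · (f.equiv V h t)) (e.map_smul V h a s)
  naturality := by
    rintro V W hV hW i ⟨s, t⟩
    exact congrArg₂ tmul (e.naturality V W hV hW i s) (f.naturality V W hV hW i t)

variable (X) in
/-- The isomorphism `𝒪_X ⊗ 𝒪_X ≅ 𝒪_X` of presheaves. -/
def tensorStructure (U : Opens X.space) :
    IsoOn ((structureOSet X).tensorPresheaf (structureOSet X)) (structureOSet X) U where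
  equiv := fun V _ =>
    { toFun := Quot.lift (fun p : X.Sec V × X.Sec V => p.1 * p.2) (by
        rintro _ _ ⟨b, s, t⟩
        exact (mul_assoc b s t).trans (mul_left_comm b s t))
      invFun := fun a => tmul (A := structureOSet X) (B := structureOSet X) a (1 : X.Sec V)
      left_inv := by
        rintro ⟨s, t⟩
        have h := smul_tmul (A := structureOSet X) (B := structureOSet X) (U := V) t s (1 : X.Sec V)
        refine (congrArg (fun r => tmul (A := structureOSet X) (B := structureOSet X) r
          (1 : X.Sec V)) (mul_comm (G := X.Sec V) s t)).trans (h.trans ?_)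
        exact congrArg (tmul (A := structureOSet X) (B := structureOSet X) s) (mul_one (M := X.Sec V) t)
      right_inv := fun a => mul_one (M := X.Sec V) a }
  map_smul := by
    rintro V h a ⟨s, t⟩
    exact mul_assoc (G := X.Sec V) a s t
  naturality := by
    rintro V W hV hW i ⟨s, t⟩
    exact (X.map_mul i s t).symm

/-- The cocone defining `stalkMap`. -/
def stalkCocone (e : IsoOn A B U) (x : X.space) (hx : x ∈ U) :
    Limits.Cocone ((OpenNhds.inclusion x).op ⋙ A.presheaf) where
  pt := B.presheaf.stalk x
  ι :=
    { app := fun V => ↾(fun s => B.presheaf.germ (V.unop.1 ⊓ U) x ⟨V.unop.2, hx⟩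
        (e.equiv (V.unop.1 ⊓ U) inf_le_right (A.res (Opens.infLELeft V.unop.1 U) s)))
      naturality := fun V W i => by
        have key : ∀ {V W : Opens X.space} (i : W ⟶ V) (hW : x ∈ W) (s : A.Sec V),
            B.presheaf.germ (W ⊓ U) x ⟨hW, hx⟩
              (e.equiv (W ⊓ U) inf_le_right (A.res (Opens.infLELeft W U) (A.res i s))) =
            B.presheaf.germ (V ⊓ U) x ⟨i.le hW, hx⟩
              (e.equiv (V ⊓ U) inf_le_right (A.res (Opens.infLELeft V U) s)) := by
          intro V W i hW s
          refine TopCat.Presheaf.germ_ext _ (W ⊓ U) ⟨hW, hx⟩ (𝟙 _)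
            (homOfLE (inf_le_inf_right U i.le)) ?_
          change B.res _ (e.equiv _ _ _) = B.res _ (e.equiv _ _ _)
          rw [← e.naturality _ _ _ inf_le_right, ← e.naturality _ _ _ inf_le_right,
            A.res_res _ _ (Opens.infLELeft W U), A.res_res _ _ (homOfLE (inf_le_left.trans i.le)),
            A.res_res _ _ (homOfLE (inf_le_left.trans i.le))]
        ext s
        exact key ((OpenNhds.inclusion x).map i.unop) W.unop.2 s }

/-- The map induced by an isomorphism on stalks. -/
def stalkMap (e : IsoOn A B U) (x : X.space) (hx : x ∈ U) :
    A.presheaf.stalk x ⟶ B.presheaf.stalk x :=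
  Limits.colimit.desc _ (e.stalkCocone x hx)

lemma stalkMap_germ (e : IsoOn A B U) (x : X.space) (hx : x ∈ U) {V : Opens X.space} (h : V ≤ U)
    (hV : x ∈ V) (s : A.Sec V) :
    e.stalkMap x hx (A.presheaf.germ V x hV s) = B.presheaf.germ V x hV (e.equiv V h s) := by
  have h' : e.stalkMap x hx (A.presheaf.germ V x hV s) = B.presheaf.germ (V ⊓ U) x ⟨hV, hx⟩
      (e.equiv (V ⊓ U) inf_le_right (A.res (Opens.infLELeft V U) s)) :=
    Limits.colimit.ι_desc_apply (e.stalkCocone x hx) (op (⟨V, hV⟩ : OpenNhds x)) s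
  rw [h']
  refine TopCat.Presheaf.germ_ext _ V hV (homOfLE (le_inf le_rfl h)) (𝟙 _) ?_
  change B.res _ (e.equiv _ _ _) = B.res _ (e.equiv _ _ _)
  rw [← e.naturality _ _ _ h, A.res_res _ _ (𝟙 _), A.res_id, B.res_id]

lemma stalkMap_symm (e : IsoOn A B U) (x : X.space) (hx : x ∈ U) (t : A.presheaf.stalk x) :
    e.symm.stalkMap x hx (e.stalkMap x hx t) = t := by
  obtain ⟨V, hV, hxV, s, rfl⟩ := A.presheaf.exists_le_germ_eq t hx
  rw [e.stalkMap_germ x hx hV, e.symm.stalkMap_germ x hx hV]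
  exact congrArg _ ((e.equiv V hV).symm_apply_apply s)

/-- The map induced by an isomorphism on sections of the sheafifications. -/
def sheafificationMap (e : IsoOn A B U) (V : Opens X.space) (h : V ≤ U)
    (s : A.sheafification.Sec V) : B.sheafification.Sec V :=
  ⟨fun x => e.stalkMap x.1 (h x.2) (s.1 x), fun x => by
    obtain ⟨W, hW, i, t, ht⟩ := s.2 x
    exact ⟨W, hW, i, e.equiv W (i.le.trans h) t, fun y =>
      (congrArg _ (ht y)).trans (e.stalkMap_germ _ _ (i.le.trans h) y.2 t)⟩⟩

/-- The isomorphism induced on sheafifications. -/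
def sheafification (e : IsoOn A B U) : IsoOn A.sheafification B.sheafification U where
  equiv := fun V h =>
    { toFun := e.sheafificationMap V h
      invFun := e.symm.sheafificationMap V h
      left_inv := fun s => Subtype.ext (funext fun x => e.stalkMap_symm _ _ _)
      right_inv := fun s => Subtype.ext (funext fun x => e.symm.stalkMap_symm _ _ _) }
  map_smul := fun V h a s => Subtype.ext (funext fun x => by
    change e.stalkMap x.1 (h x.2) (A.stalkAct a x.1 x.2 (s.1 x)) =
      B.stalkAct a x.1 x.2 (e.stalkMap x.1 (h x.2) (s.1 x))
    obtain ⟨W, hW, i, t, ht⟩ := s.2 x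
    rw [show s.1 x = _ from ht ⟨x, hW⟩, A.stalkAct_germ _ _ _ i,
      e.stalkMap_germ _ _ (i.le.trans h), e.stalkMap_germ _ _ (i.le.trans h),
      B.stalkAct_germ _ _ _ i, e.map_smul])
  naturality := fun _ _ _ _ _ _ => rfl

/-- The tensor product of isomorphisms. -/
def tensor (e : IsoOn A A' U) (f : IsoOn B B' U) : IsoOn (A.tensor B) (A'.tensor B') U :=
  (e.tensorPresheaf f).sheafification

end IsoOn

lemma toSheafify_bijective (A : OSetPresheaf X) (hA : A.presheaf.IsSheaf) (V : Opens X.space) :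
    Function.Bijective (A.presheaf.toSheafify.app (op V)) := by
  let F : TopCat.Sheaf (Type u) X.space := ⟨A.presheaf, hA⟩
  have inj : ∀ V : Opens X.space, Function.Injective (A.presheaf.toSheafify.app (op V)) := by
    intro V s t h
    exact TopCat.Presheaf.section_ext F V s t fun x hx =>
      congrFun (congrArg Subtype.val h) (⟨x, hx⟩ : V)
  refine ⟨inj V, fun s => ?_⟩
  have hs : ∀ x : V, ∃ W : Opens X.space, x.1 ∈ W ∧ ∃ (i : W ⟶ V) (t : A.Sec W),
      A.sheafification.res i s = A.presheaf.toSheafify.app (op W) t := by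
    intro x
    obtain ⟨W, hW, i, t, ht⟩ := s.2 x
    exact ⟨W, hW, i, t, Subtype.ext (funext ht)⟩
  choose W hW i t ht using hs
  have nat : ∀ {V W : Opens X.space} (i : W ⟶ V) (t : A.Sec V),
      A.presheaf.toSheafify.app (op W) (A.res i t) =
        A.sheafification.res i (A.presheaf.toSheafify.app (op V) t) := fun i t =>
    NatTrans.naturality_apply A.presheaf.toSheafify i.op t
  have hc : V ≤ iSup W := fun x hx => Opens.mem_iSup.2 ⟨⟨x, hx⟩, hW ⟨x, hx⟩⟩
  obtain ⟨r, hr, -⟩ := F.existsUnique_gluing' W V i hc t (fun x y => by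
    refine inj _ ?_
    refine (nat (Opens.infLELeft (W x) (W y)) (t x)).trans (Eq.trans ?_
      (nat (Opens.infLERight (W x) (W y)) (t y)).symm)
    rw [← ht, ← ht]
    rfl)
  refine ⟨r, TopCat.Sheaf.eq_of_locally_eq' A.presheaf.sheafify W V i hc _ _ fun x => ?_⟩
  refine (nat (i x) r).symm.trans (Eq.trans ?_ (ht x).symm)
  exact congrArg _ (hr x)

/-- A sheaf of `𝒪_X`-sets is isomorphic to its sheafification. -/
def isoSheafification (A : OSetPresheaf X) (hA : A.presheaf.IsSheaf) (U : Opens X.space) :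
    IsoOn A A.sheafification U where
  equiv := fun V _ => Equiv.ofBijective _ (A.toSheafify_bijective hA V)
  map_smul := fun V _ a s => Subtype.ext (funext fun x => by
    change A.presheaf.germ V x.1 x.2 (a • s) = A.stalkAct a x.1 x.2 (A.presheaf.germ V x.1 x.2 s)
    rw [A.stalkAct_germ _ _ _ (𝟙 V), X.res_id])
  naturality := fun _ _ _ _ i s => NatTrans.naturality_apply A.presheaf.toSheafify i.op s

variable (X) in
lemma isInvertible_structureOSet : IsInvertible (structureOSet X) where
  isSheaf := X.sheaf.property
  locally_trivial := fun _ => ⟨⊤, trivial, ⟨IsoOn.refl _ _⟩⟩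

lemma IsInvertible.tensor {A B : OSetPresheaf X} (hA : IsInvertible A) (hB : IsInvertible B) :
    IsInvertible (A.tensor B) where
  isSheaf := (A.tensorPresheaf B).presheaf.sheafify.property
  locally_trivial := fun x => by
    obtain ⟨U, hU, ⟨e⟩⟩ := hA.locally_trivial x
    obtain ⟨V, hV, ⟨f⟩⟩ := hB.locally_trivial x
    exact ⟨U ⊓ V, ⟨hU, hV⟩,
      ⟨(((e.restrict inf_le_left).tensorPresheaf (f.restrict inf_le_right)).trans
        (IsoOn.tensorStructure X _)).sheafification.trans
        (isoSheafification _ (isInvertible_structureOSet X).isSheaf _).symm⟩⟩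

end OSetPresheaf

/-! ## The Picard group -/

/-- Invertible sheaves on a monoidal space `X`: sheaves of `𝒪_X`-sets which are locally isomorphic
to `𝒪_X`. -/
def InvertibleSheaf (X : MonoidalSpace.{u}) : Type (u + 1) :=
  {A : OSetPresheaf X // A.IsInvertible}

/-- Isomorphism of invertible sheaves. -/
instance InvertibleSheaf.setoid (X : MonoidalSpace.{u}) : Setoid (InvertibleSheaf X) where
  r A B := Nonempty (OSetPresheaf.IsoOn A.1 B.1 ⊤)
  iseqv := ⟨fun A => ⟨.refl A.1 ⊤⟩, fun ⟨e⟩ => ⟨e.symm⟩, fun ⟨e⟩ ⟨f⟩ => ⟨e.trans f⟩⟩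

/-- The Picard group: the set of isomorphism classes of invertible sheaves. -/
def Pic (X : MonoidalSpace.{u}) : Type (u + 1) := Quotient (InvertibleSheaf.setoid X)

/-- The group law of the Picard group, induced by the tensor product. -/
instance (X : MonoidalSpace.{u}) : Mul (Pic X) where
  mul := Quotient.map₂ (fun A B => ⟨A.1.tensor B.1, A.2.tensor B.2⟩)
    (fun _ _ ⟨e⟩ _ _ ⟨f⟩ => ⟨e.tensor f⟩)

/-! ## The sheaves `𝒪_X^×` and `𝒦^×` -/

namespace MonoidalSpace

/-- The presheaf `U ↦ 𝒪_X(U)^×` of abelian groups (written additively). -/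
def unitsPresheaf (X : MonoidalSpace.{u}) : TopCat.Presheaf AddCommGrpCat.{u} X.space where
  obj U := AddCommGrpCat.of (Additive (X.Sec U.unop)ˣ)
  map i := AddCommGrpCat.ofHom (Units.map (X.res i.unop : X.Sec _ →* X.Sec _)).toAdditive
  map_id U := by
    ext a
    exact congrArg Additive.ofMul (Units.ext (X.res_id (𝟙 _) ((Additive.toMul (α := (X.Sec U.unop)ˣ) a : (X.Sec U.unop)ˣ) :
      X.Sec U.unop)))
  map_comp {U V W} i j := by
    ext a
    exact congrArg Additive.ofMul (Units.ext (X.res_res i.unop j.unop (j.unop ≫ i.unop)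
      ((Additive.toMul (α := (X.Sec U.unop)ˣ) a : (X.Sec U.unop)ˣ) : X.Sec U.unop)).symm)

/-- A section of `𝒪_X^×` as a section of `𝒪_X`. -/
def unitsVal (X : MonoidalSpace.{u}) {U : Opens X.space} (a : X.unitsPresheaf.obj (op U)) :
    X.Sec U := ((Additive.toMul (α := (X.Sec U)ˣ) a : (X.Sec U)ˣ) : X.Sec U)

lemma unitsVal_injective (X : MonoidalSpace.{u}) (U : Opens X.space) :
    Function.Injective (X.unitsVal (U := U)) :=
  fun _ _ h => congrArg Additive.ofMul (Units.ext h)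

lemma unitsVal_map (X : MonoidalSpace.{u}) {U V : Opens X.space} (i : V ⟶ U)
    (a : X.unitsPresheaf.obj (op U)) :
    X.unitsVal (X.unitsPresheaf.map i.op a) = X.res i (X.unitsVal a) := rfl

lemma unitsVal_mul_neg (X : MonoidalSpace.{u}) {U : Opens X.space}
    (a : X.unitsPresheaf.obj (op U)) : X.unitsVal a * X.unitsVal (-a) = 1 :=
  Units.mul_inv (Additive.toMul (α := (X.Sec U)ˣ) a)

theorem isSheaf_unitsPresheaf (X : MonoidalSpace.{u}) : X.unitsPresheaf.IsSheaf := by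
  rw [TopCat.Presheaf.isSheaf_iff_isSheafUniqueGluing]
  intro ι U sf h
  obtain ⟨a, ha, ha'⟩ := X.sheaf.existsUnique_gluing U (fun i => X.unitsVal (sf i))
    (fun i j => congrArg X.unitsVal (h i j))
  obtain ⟨b, hb, -⟩ := X.sheaf.existsUnique_gluing U (fun i => X.unitsVal (-(sf i)))
    (fun i j => by
      have h' := congrArg (fun c => X.unitsVal (-c)) (h i j)
      simp only [← map_neg] at h'
      exact h')
  have hab : (show X.Sec (iSup U) from a) * (show X.Sec (iSup U) from b) = 1 := by
    refine X.sheaf.eq_of_locally_eq U _ _ fun i => ?_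
    refine (X.map_mul _ _ _).trans (Eq.trans ?_ (X.map_one _).symm)
    exact (congrArg₂ (fun c d : X.Sec (U i) => c * d) (ha i) (hb i)).trans
      (X.unitsVal_mul_neg (sf i))
  refine ⟨Additive.ofMul (⟨a, b, hab, (mul_comm (G := X.Sec (iSup U)) b a).trans hab⟩ :
    (X.Sec (iSup U))ˣ), fun i => X.unitsVal_injective _ (ha i), fun c hc => ?_⟩
  exact X.unitsVal_injective _ (ha' (X.unitsVal c) fun i => congrArg X.unitsVal (hc i))

/-- The sheaf `𝒪_X^×` of abelian groups of units of the structure sheaf. -/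
def unitsSheaf (X : MonoidalSpace.{u}) : TopCat.Sheaf AddCommGrpCat.{u} X.space :=
  ⟨X.unitsPresheaf, X.isSheaf_unitsPresheaf⟩

end MonoidalSpace

/-- The constant sheaf on a space `X` associated with an abelian group `G` (written
multiplicatively), as a sheaf of additive abelian groups. -/
def constantSheafOf (X : TopCat.{u}) (G : Type u) [CommGroup G] :
    TopCat.Sheaf AddCommGrpCat.{u} X :=
  (constantSheaf (Opens.grothendieckTopology X) AddCommGrpCat.{u}).obj
    (AddCommGrpCat.of (Additive G))

end

noncomputable section

/-! ## Sheaves of abelian groups -/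

/-! Cohomology turns the projection from `𝒦^× × 𝒪_X^×` to `𝒪_X^×` into an isomorphism on `H¹` as
soon as `H¹(X, 𝒦^×) = 0` (`HOneProdEquiv`). This vanishing is where irreducibility enters: any two
non-empty open sets meet, so sections of a constant sheaf over a non-empty open set are constant and
extend, and the sheaf is flasque (`isFlasque_constantSheaf`, `H_one_eq_zero_of_isFlasque`). It
remains to show `Pic(X) ≅ H¹(X, 𝒪_X^×)`, which is `nonempty_pic_mulEquiv`.

Here `H¹` is an Ext group, and it is compared with cocycles through one exact sequence `0 → 𝒪_X^× →
G → Q → 0`, where `G` is the sheaf of arbitrary families of germs of units. Since `G` is flasque,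
`H¹(X, 𝒪_X^×)` is the cokernel of `G(X) → Q(X)` (`exists_connecting`). A section `q` of `Q` over `X`
is the same as a cocycle up to the choice of local lifts: lifts `t x` of `q` to `G` differ on
overlaps by units.

Local generators of an invertible sheaf differ by units. These form a cocycle, which becomes a
coboundary in `G` by an explicit formula (`exists_coboundary`); the resulting `t x` glue to some `q`
in `Q(X)`. The predicate `HasClass` records that generators and lifts have the same transition
units. Every invertible sheaf has a class (`IsInvertible.exists_hasClass`). Two of them are
isomorphic exactly when their classes differ by the image of `G(X)` (`HasClass.nonempty_isoOn`,
`HasClass.exists_of_isoOn`). Tensor products add classes (`HasClass.tensor`).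

Conversely, `twistedPresheaf q` realises `q`. Its sections are families of coordinates indexed by
all local lifts of `q` rather than by a chosen covering, so that restriction and gluing need no
refinement of coverings. -/

/-- Sheaves of abelian groups on a topological space. -/
abbrev AbSheaf (X : TopCat.{u}) := Sheaf (Opens.grothendieckTopology X) AddCommGrpCat.{u}

namespace AbSheaf

variable {X : TopCat.{u}}

/-- The group of sections over `V`. -/
abbrev Sec (F : AbSheaf X) (V : Opens X) : Type u := F.obj.obj (op V)

/-- The restriction homomorphism. -/
def rest (F : AbSheaf X) {V W : Opens X} (h : W ≤ V) : F.Sec V →+ F.Sec W :=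
  (F.obj.map (homOfLE h).op).hom

/-- The homomorphism on sections induced by a morphism of sheaves. -/
def app {F G : AbSheaf X} (f : F ⟶ G) (V : Opens X) : F.Sec V →+ G.Sec V :=
  (f.hom.app (op V)).hom

@[simp]
lemma rest_self (F : AbSheaf X) {V : Opens X} (h : V ≤ V) (s : F.Sec V) : F.rest h s = s := by
  change F.obj.map (𝟙 _) s = s
  simp

@[simp]
lemma rest_rest (F : AbSheaf X) {V W Z : Opens X} (h : W ≤ V) (k : Z ≤ W) (s : F.Sec V) :
    F.rest k (F.rest h s) = F.rest (k.trans h) s := by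
  change F.obj.map (homOfLE k).op (F.obj.map (homOfLE h).op s) = F.obj.map (homOfLE (k.trans h)).op s
  rw [← ConcreteCategory.comp_apply, ← F.obj.map_comp]
  rfl

lemma app_rest {F G : AbSheaf X} (f : F ⟶ G) {V W : Opens X} (h : W ≤ V) (s : F.Sec V) :
    app f W (F.rest h s) = G.rest h (app f V s) :=
  NatTrans.naturality_apply f.hom (homOfLE h).op s

lemma eq_of_locally_eq (F : AbSheaf X) {V : Opens X} (s t : F.Sec V)
    (h : ∀ x ∈ V, ∃ (W : Opens X) (hW : W ≤ V), x ∈ W ∧ F.rest hW s = F.rest hW t) : s = t := by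
  choose! W hW hx hs using h
  exact TopCat.Sheaf.eq_of_locally_eq' F (fun x : V => W x.1) V (fun x => homOfLE (hW x.1 x.2))
    (fun x hx' => Opens.mem_iSup.2 ⟨⟨x, hx'⟩, hx x hx'⟩) s t (fun x => hs x.1 x.2)

lemma exists_gluing (F : AbSheaf X) {ι : Type*} (U : ι → Opens X) (V : Opens X)
    (hU : ∀ i, U i ≤ V) (hV : ∀ x ∈ V, ∃ i, x ∈ U i) (s : ∀ i, F.Sec (U i))
    (h : ∀ i j, F.rest (inf_le_left : U i ⊓ U j ≤ U i) (s i) = F.rest inf_le_right (s j)) :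
    ∃ t : F.Sec V, ∀ i, F.rest (hU i) t = s i :=
  (TopCat.Sheaf.existsUnique_gluing' F U V (fun i => homOfLE (hU i))
    (fun x hx => Opens.mem_iSup.2 (hV x hx)) s h).exists

lemma app_g_app_f (S : ShortComplex (AbSheaf X)) {V : Opens X} (u : S.X₁.Sec V) : app S.g V (app S.f V u) = 0 := by
  have : S.f.hom.app (op V) ≫ S.g.hom.app (op V) = 0 := by
    rw [← NatTrans.comp_app, ← ObjectProperty.FullSubcategory.comp_hom, S.zero]
    rfl
  exact ConcreteCategory.congr_hom this u

section ShortExact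

variable {S : ShortComplex (AbSheaf X)} (hS : S.ShortExact)

include hS

lemma exists_lift {V : Opens X} (q : S.X₃.Sec V) {x : X} (hx : x ∈ V) :
    ∃ (W : Opens X) (hW : W ≤ V), x ∈ W ∧ ∃ t : S.X₂.Sec W, app S.g W t = S.X₃.rest hW q := by
  have := (TopCat.Sheaf.isLocallySurjective_iff_epi S.g).mpr hS.epi_g
  obtain ⟨W, hW, ⟨t, ht⟩, hxW⟩ := (TopCat.Presheaf.isLocallySurjective_iff S.g.hom).mp this V q x hx
  exact ⟨W, hW, hxW, t, ht⟩

lemma exists_of_app_eq_zero {V : Opens X} (t : S.X₂.Sec V) (ht : app S.g V t = 0) :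
    ∃ u : S.X₁.Sec V, app S.f V u = t :=
  TopCat.Sheaf.sections_exact_of_left_exact hS.exact hS.mono_f t ht

end ShortExact

/-! ### Cohomology in degree one -/

/-- The connecting homomorphism of a short exact sequence whose middle term is acyclic. -/
lemma exists_connecting {S : ShortComplex (AbSheaf X)} (hS : S.ShortExact)
    (h : ∀ x : Sheaf.H S.X₂ 1, x = 0) :
    ∃ δ : S.X₃.Sec ⊤ →+ Sheaf.H S.X₁ 1, Function.Surjective δ ∧
      ∀ q, δ q = 0 ↔ ∃ a, app S.g ⊤ a = q := by
  have hT : Limits.IsTerminal (⊤ : Opens X) := Limits.isTerminalTop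
  let e := Sheaf.H.equiv₀ S.X₃ hT
  -- The connecting map is the Yoneda product with the extension class, after identifying `H⁰` with
  -- global sections. The claims are then exactness of the long Ext sequence at `H¹(X₁)` and at
  -- `H⁰(X₃)`.
  refine ⟨(hS.extClass.postcomp _ (zero_add 1)).comp e.symm.toAddMonoidHom, fun y => ?_,
    fun q => ⟨fun hq => ?_, ?_⟩⟩
  · obtain ⟨x, hx⟩ := Abelian.Ext.covariant_sequence_exact₁ _ hS y (h _) (zero_add 1)
    exact ⟨e x, by simpa using hx⟩
  · obtain ⟨x, hx⟩ := Abelian.Ext.covariant_sequence_exact₃ _ hS (e.symm q) (zero_add 1) hq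
    refine ⟨Sheaf.H.equiv₀ S.X₂ hT x, (Sheaf.H.equiv₀_naturality hT S.g x).trans ?_⟩
    exact (congrArg e hx).trans (e.apply_symm_apply q)
  · rintro ⟨a, rfl⟩
    have : e.symm (app S.g ⊤ a) = Sheaf.H.map S.g 0 ((Sheaf.H.equiv₀ S.X₂ hT).symm a) :=
      (Sheaf.H.equiv₀_symm_naturality hT S.g a).symm
    change (e.symm (app S.g ⊤ a)).comp hS.extClass (zero_add 1) = 0
    rw [this, Sheaf.H.map_apply, Abelian.Ext.comp_assoc_of_second_deg_zero,
      hS.comp_extClass, Abelian.Ext.comp_zero]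

/-- Embed `F` into an injective sheaf. As `F` is flasque, every global section of the quotient
lifts, so the connecting map is zero; it is also surjective onto `H¹`. -/
lemma H_one_eq_zero_of_isFlasque (F : AbSheaf X) [TopCat.Sheaf.IsFlasque F] (x : Sheaf.H F 1) :
    x = 0 := by
  let S : ShortComplex (AbSheaf X) :=
    ShortComplex.mk (Injective.ι F) (Limits.cokernel.π _) (Limits.cokernel.condition _)
  have hS : S.ShortExact :=
    { exact := ShortComplex.exact_of_g_is_cokernel _ (Limits.cokernelIsCokernel _) }
  obtain ⟨δ, hδ, hδ'⟩ := exists_connecting hS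
    (fun x => Abelian.Ext.eq_zero_of_injective (I := Injective.under F) x)
  obtain ⟨q, rfl⟩ := hδ x
  have : TopCat.Sheaf.IsFlasque S.X₁ := ‹_›
  have h := TopCat.Sheaf.IsFlasque.epi_of_shortExact (U := ⊤) hS
  exact (hδ' q).2 ((AddCommGrpCat.epi_iff_surjective _).1 h q)

lemma isFlasque_of_surjective (F : AbSheaf X)
    (h : ∀ {V W : Opens X} (i : W ≤ V), Function.Surjective (F.rest i)) :
    TopCat.Sheaf.IsFlasque F where
  epi i := (AddCommGrpCat.epi_iff_surjective _).2 (h i.unop.le)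

/-- If `A` is acyclic in degree one, then `A × B` and `B` have the same first cohomology. -/
def HOneProdEquiv (A B : AbSheaf X) (h : ∀ x : Sheaf.H A 1, x = 0) :
    Sheaf.H (Limits.prod A B) 1 ≃+ Sheaf.H B 1 :=
  AddEquiv.ofBijective (Sheaf.H.map (Limits.prod.snd : Limits.prod A B ⟶ B) 1) (by
    -- Decomposing the identity through the two factors splits a class on the product into two
    -- parts, and the part that passes through `A` vanishes.
    have id_eq : 𝟙 (Limits.prod A B) = Limits.prod.fst ≫ Limits.prod.lift (𝟙 A) 0 +
        Limits.prod.snd ≫ Limits.prod.lift 0 (𝟙 B) := by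
      ext1 <;> simp [Preadditive.add_comp, Limits.prod.lift_fst, Limits.prod.lift_snd]
    constructor
    · refine (injective_iff_map_eq_zero _).2 fun x hx => ?_
      rw [← Sheaf.H.map_id_apply (x := x), id_eq, Sheaf.H.map_add_apply, Sheaf.H.map_comp_apply,
        Sheaf.H.map_comp_apply, hx, h (Sheaf.H.map _ 1 x), map_zero, map_zero, add_zero]
    · intro y
      refine ⟨Sheaf.H.map (Limits.prod.lift 0 (𝟙 B)) 1 y, ?_⟩
      rw [← Sheaf.H.map_comp_apply, Limits.prod.lift_snd, Sheaf.H.map_id_apply])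

/-! ### The constant sheaf on an irreducible space -/

lemma Sec.eq_of_isEmpty (F : AbSheaf X) {V : Opens X} (h : ∀ x, x ∉ V) (s t : F.Sec V) : s = t :=
  F.eq_of_locally_eq s t fun x hx => (h x hx).elim

/-- A section is locally constant in the sense of coming from an element of `A`. Two such local
values agree because their open sets meet, so a section over a non-empty open set is globally one
constant and extends. -/
lemma isFlasque_constantSheaf [IrreducibleSpace X] (A : AddCommGrpCat.{u}) :
    TopCat.Sheaf.IsFlasque (X := X)
      ((constantSheaf (Opens.grothendieckTopology X) AddCommGrpCat.{u}).obj A) := by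
  let J := Opens.grothendieckTopology X
  let P : (Opens X)ᵒᵖ ⥤ AddCommGrpCat.{u} := (Functor.const _).obj A
  let F : AbSheaf X := (constantSheaf J AddCommGrpCat.{u}).obj A
  change TopCat.Sheaf.IsFlasque F
  let η : ∀ V : Opens X, A → F.Sec V := fun V a => (toSheafify J P).app (op V) a
  have η_rest : ∀ {V W : Opens X} (h : W ≤ V) (a : A), F.rest h (η V a) = η W a := fun h a =>
    (NatTrans.naturality_apply (toSheafify J P) (homOfLE h).op a).symm
  -- A point in `V` is needed: constants with equal image agree in the constant presheaf on some
  -- neighbourhood of it, where restriction is the identity of `A`.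
  have η_inj : ∀ (V : Opens X) (x : X), x ∈ V → Function.Injective (η V) := by
    intro V x hx a b hab
    have := Presheaf.equalizerSieve_mem J (toSheafify J P) (X := op V) a b hab
    obtain ⟨W, i, hi, -⟩ := this x hx
    exact hi
  have η_surj : ∀ (V : Opens X) (s : F.Sec V) (x : X), x ∈ V →
      ∃ (W : Opens X) (h : W ≤ V) (a : A), x ∈ W ∧ F.rest h s = η W a := by
    intro V s x hx
    obtain ⟨W, i, ⟨a, ha⟩, hW⟩ := Presheaf.imageSieve_mem J (toSheafify J P) s x hx
    exact ⟨W, i.le, a, hW, ha.symm⟩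
  refine isFlasque_of_surjective F fun {V W} i s => ?_
  by_cases hW : ∃ x, x ∈ W
  · obtain ⟨x, hx⟩ := hW
    obtain ⟨W₀, h₀, a, hx₀, ha⟩ := η_surj W s x hx
    refine ⟨η V a, (η_rest i a).trans (F.eq_of_locally_eq _ _ fun y hy => ?_)⟩
    obtain ⟨W₁, h₁, b, hy₁, hb⟩ := η_surj W s y hy
    -- Irreducibility supplies a common point at which the two local constants can be compared.
    obtain ⟨z, -, hz₀, hz₁⟩ := (IrreducibleSpace.isIrreducible_univ X).2 W₀ W₁ W₀.2 W₁.2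
      ⟨x, trivial, hx₀⟩ ⟨y, trivial, hy₁⟩
    have hab : a = b := by
      refine η_inj (W₀ ⊓ W₁) z ⟨hz₀, hz₁⟩ ?_
      rw [← η_rest (inf_le_left : W₀ ⊓ W₁ ≤ W₀), ← η_rest (inf_le_right : W₀ ⊓ W₁ ≤ W₁), ← ha, ← hb,
        rest_rest, rest_rest]
    exact ⟨W₁, h₁, hy₁, by rw [hb, η_rest, hab]⟩
  -- Over an empty open set all sections agree, so any section extends; `0` is a choice.
  · exact ⟨0, Sec.eq_of_isEmpty F (fun x hx => hW ⟨x, hx⟩) _ _⟩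

/-! ### Discontinuous sections -/

/-- The presheaf of families of germs. -/
def godementPresheaf (F : AbSheaf X) : TopCat.Presheaf AddCommGrpCat.{u} X where
  obj V := AddCommGrpCat.of (∀ x : V.unop, (TopCat.Sheaf.presheaf F).stalk x.1)
  map i := AddCommGrpCat.ofHom
    { toFun := fun s x => s ⟨x.1, i.unop.le x.2⟩
      map_zero' := rfl
      map_add' := fun _ _ => rfl }

/-- The sheaf of families of germs, the first term of the Godement resolution. -/
def godement (F : AbSheaf X) : AbSheaf X :=
  ⟨F.godementPresheaf, by
    refine (TopCat.Presheaf.isSheaf_iff_isSheaf_comp (forget _) _).2 ?_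
    exact TopCat.Presheaf.toTypes_isSheaf X fun x => (TopCat.Sheaf.presheaf F).stalk x⟩

/-- Families of germs satisfy no compatibility condition, so they extend by zero. -/
lemma isFlasque_godement (F : AbSheaf X) : TopCat.Sheaf.IsFlasque F.godement := by
  classical
  refine isFlasque_of_surjective _ fun {V W} i s => ?_
  refine ⟨fun x : V => if h : x.1 ∈ W then
    (show ∀ x : W, (TopCat.Sheaf.presheaf F).stalk x.1 from s) ⟨x.1, h⟩ else 0, ?_⟩
  exact funext fun x : W => dif_pos x.2

/-- The family of germs of a section. -/
def toGodement (F : AbSheaf X) : F ⟶ F.godement where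
  hom :=
    { app := fun V => AddCommGrpCat.ofHom
        { toFun := fun s x => (TopCat.Sheaf.presheaf F).germ V.unop x.1 x.2 s
          map_zero' := funext fun x => map_zero _
          map_add' := fun s t => funext fun x => map_add _ s t }
      naturality := fun V W i => by
        ext s
        exact funext fun x => (TopCat.Sheaf.presheaf F).germ_res_apply i.unop x.1 x.2 s }

lemma toGodement_injective (F : AbSheaf X) (V : Opens X) :
    Function.Injective (app F.toGodement V) := fun s t h =>
  TopCat.Presheaf.section_ext F V s t fun x hx => congrFun h (⟨x, hx⟩ : V)

lemma mono_toGodement (F : AbSheaf X) : Mono F.toGodement := by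
  have : ∀ V, Mono (((sheafToPresheaf _ _).map F.toGodement).app V) := fun V =>
    (AddCommGrpCat.mono_iff_injective _).2 (F.toGodement_injective V.unop)
  have : Mono ((sheafToPresheaf _ _).map F.toGodement) := NatTrans.mono_of_mono_app _
  exact (sheafToPresheaf _ _).mono_of_mono_map this

/-- The short exact sequence of the embedding of a sheaf into its sheaf of families of germs. -/
def godementSequence (F : AbSheaf X) : ShortComplex (AbSheaf X) :=
  ShortComplex.mk F.toGodement (Limits.cokernel.π _) (Limits.cokernel.condition _)

lemma shortExact_godementSequence (F : AbSheaf X) : F.godementSequence.ShortExact :=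
  { exact := ShortComplex.exact_of_g_is_cokernel _ (Limits.cokernelIsCokernel _)
    mono_f := F.mono_toGodement
    epi_g := inferInstanceAs (Epi (Limits.cokernel.π F.toGodement)) }

/-- Every `1`-cocycle becomes a coboundary in the sheaf of families of germs. -/
lemma exists_coboundary (F : AbSheaf X) (U : X → Opens X) (hU : ∀ x, x ∈ U x)
    (c : ∀ x y, F.Sec (U x ⊓ U y))
    (hc : ∀ x y z (W : Opens X) (hx : W ≤ U x) (hy : W ≤ U y) (hz : W ≤ U z),
      F.rest (le_inf hx hy) (c x y) + F.rest (le_inf hy hz) (c y z) =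
        F.rest (le_inf hx hz) (c x z)) :
    ∃ t : ∀ x, F.godement.Sec (U x), ∀ x y,
      app F.toGodement _ (c x y) =
        F.godement.rest inf_le_left (t x) - F.godement.rest inf_le_right (t y) := by
  -- The value of `t x` at a point `z` is the germ of `c x z`, the point itself serving as third
  -- index, which is possible because `z ∈ U z`. The cocycle identity for `x, y, z` then reads `c x
  -- y = c x z - c y z` at `z`.
  refine ⟨fun x => fun z : U x => (TopCat.Sheaf.presheaf F).germ (U x ⊓ U z) z.1 ⟨z.2, hU z.1⟩ (c x z),
    fun x y => funext fun z : (U x ⊓ U y : Opens X) => ?_⟩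
  change (TopCat.Sheaf.presheaf F).germ _ z.1 z.2 (c x y) = (TopCat.Sheaf.presheaf F).germ (U x ⊓ U z) z.1 _ (c x z) -
    (TopCat.Sheaf.presheaf F).germ (U y ⊓ U z) z.1 _ (c y z)
  have hz : z.1 ∈ U x ⊓ U y ⊓ U z.1 := ⟨z.2, hU z.1⟩
  have h := congrArg ((TopCat.Sheaf.presheaf F).germ _ z.1 hz) (hc x y z.1 (U x ⊓ U y ⊓ U z.1)
    (inf_le_left.trans inf_le_left) (inf_le_left.trans inf_le_right) inf_le_right)
  rw [map_add] at h
  refine eq_sub_of_add_eq ((congrArg₂ (· + ·) ?_ ?_).trans (h.trans ?_))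
  · exact ((TopCat.Sheaf.presheaf F).germ_res_apply (homOfLE _) z.1 hz _).symm
  · exact ((TopCat.Sheaf.presheaf F).germ_res_apply (homOfLE _) z.1 hz _).symm
  · exact (TopCat.Sheaf.presheaf F).germ_res_apply (homOfLE _) z.1 hz _

end AbSheaf

/-! ## Generators of sheaves of `𝒪_X`-sets -/

namespace MonoidalSpace

variable (X : MonoidalSpace.{u})

/-- The sheaf of units of the structure sheaf, as an object of `AbSheaf`. -/
def units : AbSheaf X.space := X.unitsSheaf

variable {X}

/-- The section of the structure sheaf underlying a unit. -/
def unitVal {V : Opens X.space} (u : X.units.Sec V) : X.Sec V := X.unitsVal u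

variable {V W : Opens X.space}

lemma unitVal_add (u v : X.units.Sec V) : unitVal (u + v) = unitVal u * unitVal v := rfl

lemma unitVal_zero : unitVal (0 : X.units.Sec V) = 1 := rfl

lemma unitVal_rest (h : W ≤ V) (u : X.units.Sec V) :
    unitVal (X.units.rest h u) = X.res (homOfLE h) (unitVal u) := rfl

lemma unitVal_injective : Function.Injective (unitVal : X.units.Sec V → X.Sec V) :=
  X.unitsVal_injective V

lemma unitVal_mul_neg (u : X.units.Sec V) : unitVal u * unitVal (-u) = 1 := X.unitsVal_mul_neg u

lemma unitVal_neg_mul (u : X.units.Sec V) : unitVal (-u) * unitVal u = 1 := by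
  rw [mul_comm, unitVal_mul_neg]

lemma exists_unitVal_eq {a b : X.Sec V} (h : a * b = 1) : ∃ u : X.units.Sec V, unitVal u = a :=
  ⟨Additive.ofMul (⟨a, b, h, (mul_comm b a).trans h⟩ : (X.Sec V)ˣ), rfl⟩

end MonoidalSpace

open MonoidalSpace

namespace OSetPresheaf

variable {X : MonoidalSpace.{u}} {A B : OSetPresheaf X}

/-- The restriction of a section to a smaller open subset. -/
def rest (A : OSetPresheaf X) {V W : Opens X.space} (h : W ≤ V) (s : A.Sec V) : A.Sec W :=
  A.res (homOfLE h) s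

@[simp]
lemma rest_self {V : Opens X.space} (h : V ≤ V) (s : A.Sec V) : A.rest h s = s := A.res_id _ s

@[simp]
lemma rest_rest {V W Z : Opens X.space} (h : W ≤ V) (k : Z ≤ W) (s : A.Sec V) :
    A.rest k (A.rest h s) = A.rest (k.trans h) s := A.res_res _ _ _ s

lemma rest_smul {V W : Opens X.space} (h : W ≤ V) (a : X.Sec V) (s : A.Sec V) :
    A.rest h (a • s) = X.res (homOfLE h) a • A.rest h s := A.res_smul _ a s

lemma rest_unitVal_smul {V W : Opens X.space} (h : W ≤ V) (u : X.units.Sec V)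
    (s : A.Sec V) : A.rest h (unitVal u • s) =
      unitVal (X.units.rest h u) • A.rest h s :=
  A.res_smul _ _ s

lemma IsoOn.equiv_rest {U V W : Opens X.space} (e : IsoOn A B U) (hV : V ≤ U) (hW : W ≤ U)
    (h : W ≤ V) (s : A.Sec V) : e.equiv W hW (A.rest h s) = B.rest h (e.equiv V hV s) :=
  e.naturality V W hV hW _ s

lemma IsInvertible.eq_of_locally_eq (hA : A.IsInvertible) {V : Opens X.space} (s t : A.Sec V)
    (h : ∀ x ∈ V, ∃ (W : Opens X.space) (hW : W ≤ V), x ∈ W ∧ A.rest hW s = A.rest hW t) :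
    s = t := by
  choose! W hW hx hs using h
  exact TopCat.Sheaf.eq_of_locally_eq' (⟨A.presheaf, hA.isSheaf⟩ : TopCat.Sheaf (Type u) X.space)
    (fun x : V => W x.1) V (fun x => homOfLE (hW x.1 x.2))
    (fun x hx' => Opens.mem_iSup.2 ⟨⟨x, hx'⟩, hx x hx'⟩) s t (fun x => hs x.1 x.2)

lemma IsInvertible.exists_gluing (hA : A.IsInvertible) {ι : Type*} (U : ι → Opens X.space)
    (V : Opens X.space) (hU : ∀ i, U i ≤ V) (hV : ∀ x ∈ V, ∃ i, x ∈ U i) (s : ∀ i, A.Sec (U i))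
    (h : ∀ i j, A.rest (inf_le_left : U i ⊓ U j ≤ U i) (s i) = A.rest inf_le_right (s j)) :
    ∃ t : A.Sec V, ∀ i, A.rest (hU i) t = s i :=
  let F : TopCat.Sheaf (Type u) X.space := ⟨A.presheaf, hA.isSheaf⟩
  (TopCat.Sheaf.existsUnique_gluing' (C := Type u) (CC := fun T => T) F U V (fun i => homOfLE (hU i))
    (fun x hx => Opens.mem_iSup.2 (hV x hx)) s h).exists

/-- A section `s` over `V` is a generator if `a ↦ a s` is an isomorphism `𝒪_V ≅ A|_V`. -/
def IsGenerator {V : Opens X.space} (s : A.Sec V) : Prop :=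
  ∀ (W : Opens X.space) (h : W ≤ V), Function.Bijective (fun a : X.Sec W => a • A.rest h s)

namespace IsGenerator

variable {V : Opens X.space} {s t : A.Sec V}

lemma rest (hs : IsGenerator s) {W : Opens X.space} (h : W ≤ V) : IsGenerator (A.rest h s) := by
  intro Z k
  simpa using hs Z (k.trans h)

lemma smul_injective (hs : IsGenerator s) : Function.Injective (fun a : X.Sec V => a • s) := by
  simpa using (hs V le_rfl).1

lemma smul_surjective (hs : IsGenerator s) : Function.Surjective (fun a : X.Sec V => a • s) := by
  simpa using (hs V le_rfl).2

/-- Each generator is a multiple of the other, and injectivity of `a ↦ a • t` forces the two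
coefficients to be inverse to each other. -/
lemma exists_unit (hs : IsGenerator s) (ht : IsGenerator t) :
    ∃ u : X.units.Sec V, s = unitVal u • t := by
  obtain ⟨a, ha⟩ := ht.smul_surjective s
  obtain ⟨b, hb⟩ := hs.smul_surjective t
  have hab : a * b = 1 := ht.smul_injective (by
    change (a * b) • t = (1 : X.Sec V) • t
    simp only at ha hb
    rw [mul_comm, mul_smul, ha, hb, one_smul])
  obtain ⟨u, rfl⟩ := exists_unitVal_eq hab
  exact ⟨u, ha.symm⟩

lemma unitVal_smul (hs : IsGenerator s) (u : X.units.Sec V) :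
    IsGenerator (unitVal u • s) := by
  intro W h
  set v := X.units.rest h u
  have : (fun a : X.Sec W => a • A.rest h (unitVal u • s)) =
      (fun a => a • A.rest h s) ∘ (fun a => a * unitVal v) := by
    funext a
    rw [rest_unitVal_smul]
    exact smul_smul _ _ _
  rw [this]
  refine (hs W h).comp (Function.bijective_iff_has_inverse.2
    ⟨fun a => a * unitVal (-v), fun a => ?_, fun a => ?_⟩)
  · exact (mul_assoc _ _ _).trans ((congrArg (a * ·) (unitVal_mul_neg v)).trans (mul_one a))
  · exact (mul_assoc _ _ _).trans ((congrArg (a * ·) (unitVal_neg_mul v)).trans (mul_one a))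

lemma map (hs : IsGenerator s) {U : Opens X.space} (e : IsoOn A B U) (h : V ≤ U) :
    IsGenerator (e.equiv V h s) := by
  intro W k
  have : (fun a : X.Sec W => a • B.rest k (e.equiv V h s)) =
      e.equiv W (k.trans h) ∘ (fun a => a • A.rest k s) := by
    funext a
    exact (congrArg (a • ·) (e.equiv_rest h (k.trans h) k s).symm).trans (e.map_smul _ _ _ _).symm
  rw [this]
  exact (e.equiv W _).bijective.comp (hs W k)

/-- The isomorphism defined by a generator. -/
def isoOn (hs : IsGenerator s) : IsoOn (structureOSet X) A V where
  equiv W h := Equiv.ofBijective _ (hs W h)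
  map_smul W h (a b : X.Sec W) := mul_smul a b (A.rest h s)
  naturality W Z hW hZ i b := by
    change X.res i (show X.Sec W from b) • A.rest hZ s =
      A.res i ((show X.Sec W from b) • A.rest hW s)
    rw [A.res_smul]
    exact congrArg _ (A.res_res _ _ _ s).symm

lemma isoOn_one (hs : IsGenerator s) : hs.isoOn.equiv V le_rfl (1 : X.Sec V) = s :=
  (one_smul (X.Sec V) (A.rest le_rfl s)).trans (rest_self _ s)

end IsGenerator

lemma isGenerator_one (V : Opens X.space) :
    IsGenerator (A := structureOSet X) (V := V) (1 : X.Sec V) := by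
  intro W h
  have : (fun a : X.Sec W => (a • (structureOSet X).rest h (1 : X.Sec V) : (structureOSet X).Sec W)) =
      id := by
    funext a
    exact (congrArg (fun b : X.Sec W => a * b) (map_one (X.res (homOfLE h)))).trans (mul_one a)
  rw [this]
  exact Function.bijective_id

/-- A local trivialisation carries the generator `1` of `𝒪_X` to a generator. -/
lemma IsInvertible.exists_generator (hA : A.IsInvertible) (x : X.space) :
    ∃ V : Opens X.space, x ∈ V ∧ ∃ s : A.Sec V, IsGenerator s := by
  obtain ⟨V, hx, ⟨e⟩⟩ := hA.locally_trivial x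
  exact ⟨V, hx, _, (isGenerator_one V).map e.symm le_rfl⟩

/-! ### Tensor products of sections -/

/-- The section `s ⊗ t` of the sheaf `A ⊗ B`. -/
def tsec {V : Opens X.space} (s : A.Sec V) (t : B.Sec V) : (A.tensor B).Sec V :=
  (A.tensorPresheaf B).presheaf.toSheafify.app (op V) (tmul s t)

lemma rest_tsec {V W : Opens X.space} (h : W ≤ V) (s : A.Sec V) (t : B.Sec V) :
    (A.tensor B).rest h (tsec s t) = tsec (A.rest h s) (B.rest h t) :=
  (NatTrans.naturality_apply (A.tensorPresheaf B).presheaf.toSheafify (homOfLE h).op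
    (tmul s t)).symm

lemma tsec_smul_left {V : Opens X.space} (a : X.Sec V) (s : A.Sec V) (t : B.Sec V) :
    tsec (a • s) t = a • tsec s t := by
  refine Subtype.ext (funext fun x => ?_)
  change (A.tensorPresheaf B).presheaf.germ V x.1 x.2 (a • tmul s t) =
    (A.tensorPresheaf B).stalkAct a x.1 x.2 ((A.tensorPresheaf B).presheaf.germ V x.1 x.2 (tmul s t))
  refine Eq.trans ?_ ((A.tensorPresheaf B).stalkAct_germ a x.1 x.2 (𝟙 V) x.2 (tmul s t)).symm
  rw [X.res_id]
  rfl

lemma tsec_smul_right {V : Opens X.space} (a : X.Sec V) (s : A.Sec V) (t : B.Sec V) :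
    tsec s (a • t) = a • tsec s t := by
  rw [← tsec_smul_left]
  exact congrArg _ (smul_tmul a s t).symm

/-- The isomorphisms given by `s` and `t` combine to `𝒪 ≅ 𝒪 ⊗ 𝒪 ≅ A ⊗ B` over `V`, sending `1` to `1
⊗ 1` and then to `s ⊗ t`; isomorphisms preserve generators. -/
lemma IsGenerator.tsec {V : Opens X.space} {s : A.Sec V} {t : B.Sec V} (hs : IsGenerator s)
    (ht : IsGenerator t) : IsGenerator (tsec s t) := by
  let O := structureOSet X
  let e : IsoOn O (A.tensor B) V :=
    (isoSheafification O (isInvertible_structureOSet X).isSheaf V).trans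
      ((IsoOn.tensorStructure X V).symm.trans (hs.isoOn.tensorPresheaf ht.isoOn)).sheafification
  convert (isGenerator_one V).map e le_rfl using 1
  refine Subtype.ext (funext fun x => ?_)
  refine Eq.trans ?_ (((IsoOn.tensorStructure X V).symm.trans
    (hs.isoOn.tensorPresheaf ht.isoOn)).stalkMap_germ x.1 x.2 le_rfl x.2 (1 : X.Sec V)).symm
  refine congrArg ((A.tensorPresheaf B).presheaf.germ V x.1 x.2) ?_
  exact (congrArg₂ tmul hs.isoOn_one ht.isoOn_one).symm

/-! ### Gluing isomorphisms -/

/-- Two sections over `V` correspond to each other with respect to families of generators if locally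
they have the same coordinates. -/
def SameCoordinates {U : X.space → Opens X.space} (s : ∀ x, A.Sec (U x)) (t : ∀ x, B.Sec (U x))
    {V : Opens X.space} (m : A.Sec V) (n : B.Sec V) : Prop :=
  ∀ (x : X.space) (W : Opens X.space) (hV : W ≤ V) (hU : W ≤ U x),
    ∃ a : X.Sec W, A.rest hV m = a • A.rest hU (s x) ∧ B.rest hV n = a • B.rest hU (t x)

section

variable {U : X.space → Opens X.space} {s : ∀ x, A.Sec (U x)} {t : ∀ x, B.Sec (U x)}

lemma SameCoordinates.symm {V : Opens X.space} {m : A.Sec V} {n : B.Sec V}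
    (h : SameCoordinates s t m n) : SameCoordinates t s n m := fun x W hV hU =>
  (h x W hV hU).imp fun _ => And.symm

lemma SameCoordinates.rest {V W : Opens X.space} {m : A.Sec V} {n : B.Sec V}
    (h : SameCoordinates s t m n) (hW : W ≤ V) : SameCoordinates s t (A.rest hW m) (B.rest hW n) :=
  fun x Z hV hU => by simpa using h x Z (hV.trans hW) hU

lemma SameCoordinates.smul {V : Opens X.space} {m : A.Sec V} {n : B.Sec V}
    (h : SameCoordinates s t m n) (b : X.Sec V) : SameCoordinates s t (b • m) (b • n) := by
  intro x W hV hU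
  obtain ⟨a, h₁, h₂⟩ := h x W hV hU
  exact ⟨X.res (homOfLE hV) b * a, by rw [rest_smul, h₁, smul_smul],
    by rw [rest_smul, h₂, smul_smul]⟩

/-- Near `x`, the coefficient of `m` with respect to the generator `s x` is unique, and it
determines the other section there. -/
lemma SameCoordinates.unique (hB : B.IsInvertible) (hU : ∀ x, x ∈ U x)
    (hs : ∀ x, IsGenerator (s x)) {V : Opens X.space} {m : A.Sec V} {n n' : B.Sec V}
    (h : SameCoordinates s t m n) (h' : SameCoordinates s t m n') : n = n' := by
  refine hB.eq_of_locally_eq n n' fun x hx => ⟨V ⊓ U x, inf_le_left, ⟨hx, hU x⟩, ?_⟩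
  obtain ⟨a, h₁, h₂⟩ := h x (V ⊓ U x) inf_le_left inf_le_right
  obtain ⟨b, h₃, h₄⟩ := h' x (V ⊓ U x) inf_le_left inf_le_right
  have : a = b := ((hs x).rest _).smul_injective (h₁.symm.trans h₃)
  rw [h₂, h₄, this]

/-- Transplanting the coordinates of `m` from the generators `s x` to the `t x` gives local sections
of `B`. They agree on overlaps because both families have the same transition functions. -/
lemma SameCoordinates.exists (hB : B.IsInvertible) (hU : ∀ x, x ∈ U x)
    (hs : ∀ x, IsGenerator (s x))
    (hst : ∀ (x y : X.space) (W : Opens X.space) (hx : W ≤ U x) (hy : W ≤ U y), ∃ u : X.Sec W,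
      A.rest hx (s x) = u • A.rest hy (s y) ∧ B.rest hx (t x) = u • B.rest hy (t y))
    {V : Opens X.space} (m : A.Sec V) : ∃ n : B.Sec V, SameCoordinates s t m n := by
  have h : ∀ x, ∃ a : X.Sec (V ⊓ U x), a • A.rest inf_le_right (s x) = A.rest inf_le_left m :=
    fun x => ((hs x).rest _).smul_surjective _
  choose a ha using h
  -- On `W`, writing `m` as a multiple of `s y` in two ways gives `a x * u = a y`; this coefficient
  -- identity is then applied to `t y`.
  have key : ∀ x y (W : Opens X.space) (hV : W ≤ V) (hx : W ≤ U x) (hy : W ≤ U y),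
      X.res (homOfLE (le_inf hV hx)) (a x) • B.rest hx (t x) =
        X.res (homOfLE (le_inf hV hy)) (a y) • B.rest hy (t y) := by
    intro x y W hV hx hy
    have hx' := congrArg (A.rest (le_inf hV hx)) (ha x)
    have hy' := congrArg (A.rest (le_inf hV hy)) (ha y)
    obtain ⟨u, h₁, h₂⟩ := hst x y W hx hy
    rw [rest_smul, rest_rest, rest_rest] at hx' hy'
    rw [h₁, smul_smul] at hx'
    rw [h₂, smul_smul]
    exact congrArg (· • B.rest hy (t y)) (((hs y).rest hy).smul_injective (hx'.trans hy'.symm))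
  obtain ⟨n, hn⟩ := hB.exists_gluing (fun x => V ⊓ U x) V (fun _ => inf_le_left)
    (fun x hx => ⟨x, hx, hU x⟩) (fun x => a x • B.rest inf_le_right (t x)) (fun x y => by
      simp only [rest_smul, rest_rest]
      exact key x y _ (inf_le_left.trans inf_le_left) _ _)
  refine ⟨n, fun x W hV hx => ⟨X.res (homOfLE (le_inf hV hx)) (a x), ?_, ?_⟩⟩
  · simpa [rest_smul] using (congrArg (A.rest (le_inf hV hx)) (ha x)).symm
  · simpa [rest_smul] using congrArg (B.rest (le_inf hV hx)) (hn x)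

/-- Two invertible sheaves with generators over the same covering and with the same transition
functions are isomorphic. -/
lemma nonempty_isoOn (hA : A.IsInvertible) (hB : B.IsInvertible) (hU : ∀ x, x ∈ U x)
    (hs : ∀ x, IsGenerator (s x)) (ht : ∀ x, IsGenerator (t x))
    (hst : ∀ (x y : X.space) (W : Opens X.space) (hx : W ≤ U x) (hy : W ≤ U y), ∃ u : X.Sec W,
      A.rest hx (s x) = u • A.rest hy (s y) ∧ B.rest hx (t x) = u • B.rest hy (t y)) :
    Nonempty (IsoOn A B ⊤) := by
  -- Having the same coordinates is a symmetric relation with unique existence on both sides, hence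
  -- the graph of a bijection. Uniqueness also gives compatibility with the action and with
  -- restriction.
  choose f hf using fun (V : Opens X.space) (m : A.Sec V) =>
    SameCoordinates.exists hB hU hs hst m
  choose g hg using fun (V : Opens X.space) (n : B.Sec V) =>
    SameCoordinates.exists hA hU ht (fun x y W hx hy => (hst x y W hx hy).imp fun _ => And.symm) n
  exact ⟨{
    equiv := fun V _ =>
      { toFun := f V
        invFun := g V
        left_inv := fun m => (hg V _).unique hA hU ht (hf V m).symm
        right_inv := fun n => (hf V _).unique hB hU hs (hg V n).symm }
    map_smul := fun V _ a m => (hf V _).unique hB hU hs ((hf V m).smul a)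
    naturality := fun V W _ _ i m => (hf W _).unique hB hU hs ((hf V m).rest i.le) }⟩

end

end OSetPresheaf

/-! ## The class of an invertible sheaf -/

namespace MonoidalSpace

variable (X : MonoidalSpace.{u})

/-- The sheaf of families of germs of units. -/
def germs : AbSheaf X.space := X.units.godement

/-- The quotient of the sheaf of families of germs of units by the sheaf of units. -/
def germsQuot : AbSheaf X.space := X.units.godementSequence.X₃

/-- The family of germs of a unit. -/
def toGerms (V : Opens X.space) : X.units.Sec V →+ X.germs.Sec V :=
  AbSheaf.app X.units.toGodement V

/-- The projection to the quotient. -/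
def toQuot (V : Opens X.space) : X.germs.Sec V →+ X.germsQuot.Sec V :=
  AbSheaf.app X.units.godementSequence.g V

lemma toGerms_injective (V : Opens X.space) : Function.Injective (X.toGerms V) :=
  X.units.toGodement_injective V

lemma toGerms_rest {V W : Opens X.space} (h : W ≤ V) (u : X.units.Sec V) :
    X.toGerms W (X.units.rest h u) = X.germs.rest h (X.toGerms V u) := AbSheaf.app_rest _ h u

lemma toQuot_rest {V W : Opens X.space} (h : W ≤ V) (t : X.germs.Sec V) :
    X.toQuot W (X.germs.rest h t) = X.germsQuot.rest h (X.toQuot V t) := AbSheaf.app_rest _ h t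

lemma toQuot_toGerms {V : Opens X.space} (u : X.units.Sec V) : X.toQuot V (X.toGerms V u) = 0 :=
  AbSheaf.app_g_app_f X.units.godementSequence u

lemma exists_germs_coboundary (U : X.space → Opens X.space) (hU : ∀ x, x ∈ U x)
    (c : ∀ x y, X.units.Sec (U x ⊓ U y))
    (hc : ∀ x y z (W : Opens X.space) (hx : W ≤ U x) (hy : W ≤ U y) (hz : W ≤ U z),
      X.units.rest (le_inf hx hy) (c x y) + X.units.rest (le_inf hy hz) (c y z) =
        X.units.rest (le_inf hx hz) (c x z)) :
    ∃ t : ∀ x, X.germs.Sec (U x), ∀ x y, X.toGerms _ (c x y) =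
      X.germs.rest inf_le_left (t x) - X.germs.rest inf_le_right (t y) :=
  X.units.exists_coboundary U hU c hc

variable {X}

/-- A lift over `V` of a global section of the quotient sheaf. -/
def IsLift (q : X.germsQuot.Sec ⊤) {V : Opens X.space} (t : X.germs.Sec V) : Prop :=
  X.toQuot V t = X.germsQuot.rest le_top q

variable {q : X.germsQuot.Sec ⊤} {V W : Opens X.space}

lemma IsLift.rest {t : X.germs.Sec V} (ht : IsLift q t) (h : W ≤ V) :
    IsLift q (X.germs.rest h t) := by
  unfold IsLift at *
  rw [toQuot_rest, ht, AbSheaf.rest_rest]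

/-- The difference of two lifts dies in the quotient, so by left exactness of sections it comes from
a unit. That unit is unique by `toGerms_injective`, which makes identities between units checkable
in `germs`. -/
lemma IsLift.exists_unit {t t' : X.germs.Sec V} (ht : IsLift q t) (ht' : IsLift q t') :
    ∃ u, X.toGerms V u = t - t' :=
  AbSheaf.exists_of_app_eq_zero X.units.shortExact_godementSequence (t - t')
    ((map_sub (X.toQuot V) t t').trans (sub_eq_zero.2 (ht.trans ht'.symm)))

variable (q) in
lemma exists_isLift (x : X.space) :
    ∃ (V : Opens X.space) (t : X.germs.Sec V), x ∈ V ∧ IsLift q t := by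
  obtain ⟨V, hV, hx, t, ht⟩ := AbSheaf.exists_lift X.units.shortExact_godementSequence q
    (x := x) trivial
  exact ⟨V, t, hx, ht⟩

end MonoidalSpace

open MonoidalSpace

namespace OSetPresheaf

variable {X : MonoidalSpace.{u}} {A B : OSetPresheaf X}

/-- A global section `q` of the quotient sheaf represents the class of `A` if `q` has local lifts and
`A` has local generators with the same transition functions. -/
def HasClass (A : OSetPresheaf X) (q : X.germsQuot.Sec ⊤) : Prop :=
  ∃ (U : X.space → Opens X.space) (t : ∀ x, X.germs.Sec (U x)) (s : ∀ x, A.Sec (U x)),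
    (∀ x, x ∈ U x) ∧ (∀ x, IsLift q (t x)) ∧ (∀ x, IsGenerator (s x)) ∧
      ∀ (x y : X.space) (W : Opens X.space) (hx : W ≤ U x) (hy : W ≤ U y) (u : X.units.Sec W),
        X.toGerms W u = X.germs.rest hx (t x) - X.germs.rest hy (t y) →
          A.rest hx (s x) = unitVal u • A.rest hy (s y)

/-- The class of a tensor product is the sum of the classes. -/
lemma HasClass.tensor {q r : X.germsQuot.Sec ⊤} (hA : A.HasClass q) (hB : B.HasClass r) :
    (A.tensor B).HasClass (q + r) := by
  obtain ⟨U, t, s, hU, ht, hs, hts⟩ := hA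
  obtain ⟨U', t', s', hU', ht', hs', hts'⟩ := hB
  refine ⟨fun x => U x ⊓ U' x,
    fun x => X.germs.rest inf_le_left (t x) + X.germs.rest inf_le_right (t' x),
    fun x => tsec (A.rest inf_le_left (s x)) (B.rest inf_le_right (s' x)),
    fun x => ⟨hU x, hU' x⟩, fun x => ?_, fun x => ((hs x).rest _).tsec ((hs' x).rest _), ?_⟩
  · exact (map_add _ _ _).trans ((congrArg₂ (· + ·) ((ht x).rest _) ((ht' x).rest _)).trans
      (map_add _ _ _).symm)
  · intro x y W hx hy u hu
    obtain ⟨v, hv⟩ := ((ht x).rest (hx.trans inf_le_left)).exists_unit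
      ((ht y).rest (hy.trans inf_le_left))
    obtain ⟨v', hv'⟩ := ((ht' x).rest (hx.trans inf_le_right)).exists_unit
      ((ht' y).rest (hy.trans inf_le_right))
    dsimp only at hx hy hu ⊢
    -- The transition unit for the summed lifts is the product of the two separate ones, matching
    -- the bilinearity of `tsec`.
    have huv : u = v + v' := by
      apply X.toGerms_injective
      rw [hu, map_add, map_add, map_add, hv, hv']
      simp only [AbSheaf.rest_rest]
      abel
    rw [rest_tsec, rest_tsec, rest_rest, rest_rest, rest_rest, rest_rest,
      hts x y W _ (hy.trans inf_le_left) v hv, hts' x y W _ (hy.trans inf_le_right) v' hv',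
      tsec_smul_left, tsec_smul_right, smul_smul, huv]
    rfl

/-- Sheaves with cohomologous classes are isomorphic. -/
lemma HasClass.nonempty_isoOn (hA : A.IsInvertible) (hB : B.IsInvertible)
    {q r : X.germsQuot.Sec ⊤} (hAq : A.HasClass q) (hBr : B.HasClass r) (a : X.germs.Sec ⊤)
    (ha : X.toQuot ⊤ a = q - r) : Nonempty (IsoOn A B ⊤) := by
  obtain ⟨U, t, s, hU, ht, hs, hts⟩ := hAq
  obtain ⟨U', t', s', hU', ht', hs', hts'⟩ := hBr
  -- Adding `a` moves the lifts of `r` to lifts of `q`. They differ from the `t x` by units `v x`,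
  -- and rescaling `s' x` by `v x` gives `B` the transition functions of `A`.
  have hta : ∀ x, IsLift q (X.germs.rest inf_le_right (t' x) + X.germs.rest le_top a :
      X.germs.Sec (U x ⊓ U' x)) := by
    intro x
    unfold IsLift
    rw [map_add, (ht' x).rest, toQuot_rest, ha, ← map_add, add_sub_cancel]
  choose v hv using fun x => ((ht x).rest (inf_le_left : U x ⊓ U' x ≤ U x)).exists_unit (hta x)
  refine OSetPresheaf.nonempty_isoOn hA hB (U := fun x => U x ⊓ U' x) (fun x => ⟨hU x, hU' x⟩)
    (fun x => (hs x).rest inf_le_left)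
    (fun x => ((hs' x).rest inf_le_right).unitVal_smul (v x)) fun x y W hx hy => ?_
  obtain ⟨u, hu⟩ := ((ht x).rest (hx.trans inf_le_left)).exists_unit
    ((ht y).rest (hy.trans inf_le_left))
  obtain ⟨u', hu'⟩ := ((ht' x).rest (hx.trans inf_le_right)).exists_unit
    ((ht' y).rest (hy.trans inf_le_right))
  refine ⟨unitVal u, ?_, ?_⟩
  · rw [rest_rest, rest_rest]
    exact hts x y W _ _ u hu
  · rw [rest_unitVal_smul, rest_unitVal_smul, rest_rest, rest_rest,
      hts' x y W _ (hy.trans inf_le_right) u' hu', smul_smul, smul_smul, ← unitVal_add,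
      ← unitVal_add]
    congr 2
    -- In `germs` both sides equal `t x - t' y - a`.
    apply X.toGerms_injective
    rw [map_add, map_add, toGerms_rest, toGerms_rest, hv, hv, hu, hu', map_sub, map_sub,
      map_add, map_add]
    simp only [AbSheaf.rest_rest]
    abel

/-- The classes of isomorphic sheaves are cohomologous. -/
lemma HasClass.exists_of_isoOn {q r : X.germsQuot.Sec ⊤} (hAq : A.HasClass q) (hBr : B.HasClass r)
    (e : IsoOn A B ⊤) : ∃ a : X.germs.Sec ⊤, X.toQuot ⊤ a = q - r := by
  obtain ⟨U, t, s, hU, ht, hs, hts⟩ := hAq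
  obtain ⟨U', t', s', hU', ht', hs', hts'⟩ := hBr
  -- The unit `v x` compares the image of `s x` under `e` with `s' x`. The sections `t x - t' x - v
  -- x` of `germs` glue to `a`, and the unit disappears in the quotient, leaving `q - r`.
  choose v hv using fun x =>
    (((hs x).rest (inf_le_left : U x ⊓ U' x ≤ U x)).map e le_top).exists_unit
      ((hs' x).rest (inf_le_right : U x ⊓ U' x ≤ U' x))
  obtain ⟨a, ha⟩ := X.germs.exists_gluing (fun x => U x ⊓ U' x) ⊤ (fun _ => le_top)
    (fun x _ => ⟨x, hU x, hU' x⟩)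
    (fun x => X.germs.rest inf_le_left (t x) - X.germs.rest inf_le_right (t' x) - X.toGerms _ (v x))
    (fun x y => by
      set W := U x ⊓ U' x ⊓ (U y ⊓ U' y)
      have hx : W ≤ U x ⊓ U' x := inf_le_left
      have hy : W ≤ U y ⊓ U' y := inf_le_right
      obtain ⟨u, hu⟩ := ((ht x).rest (hx.trans inf_le_left)).exists_unit
        ((ht y).rest (hy.trans inf_le_left))
      obtain ⟨u', hu'⟩ := ((ht' x).rest (hx.trans inf_le_right)).exists_unit
        ((ht' y).rest (hy.trans inf_le_right))
      have h₁ := congrArg (B.rest hx) (hv x)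
      have h₂ := congrArg (B.rest hy) (hv y)
      rw [← e.equiv_rest le_top le_top, rest_unitVal_smul, rest_rest, rest_rest] at h₁ h₂
      rw [hts x y W _ (hy.trans inf_le_left) u hu, e.map_smul, h₂,
        hts' x y W _ (hy.trans inf_le_right) u' hu', smul_smul, smul_smul, ← unitVal_add,
        ← unitVal_add] at h₁
      -- Computing the image of `s x` through `s y` and through `s' x` yields two multiples of the
      -- generator `s' y`; equality of their coefficients is the gluing condition.
      have h₃ := congrArg (X.toGerms W)
        (unitVal_injective (((hs' y).rest (hy.trans inf_le_right)).smul_injective h₁))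
      rw [map_add, map_add, toGerms_rest, toGerms_rest, hu, hu'] at h₃
      simp only [map_sub, AbSheaf.rest_rest]
      rw [← sub_eq_zero] at h₃ ⊢
      rw [← h₃]
      abel)
  refine ⟨a, X.germsQuot.eq_of_locally_eq _ _ fun x _ =>
    ⟨U x ⊓ U' x, le_top, ⟨hU x, hU' x⟩, ?_⟩⟩
  rw [← toQuot_rest, ha, map_sub, map_sub, (ht x).rest, (ht' x).rest,
    toQuot_toGerms, sub_zero, map_sub]

/-- Every invertible sheaf has a class. -/
lemma IsInvertible.exists_hasClass (hA : A.IsInvertible) : ∃ q, A.HasClass q := by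
  choose U hU s hs using hA.exists_generator
  choose c hc using fun x y => ((hs x).rest (inf_le_left : U x ⊓ U y ≤ U x)).exists_unit
    ((hs y).rest inf_le_right)
  have hc' : ∀ x y (W : Opens X.space) (hx : W ≤ U x) (hy : W ≤ U y),
      A.rest hx (s x) =
        unitVal (X.units.rest (le_inf hx hy) (c x y)) • A.rest hy (s y) := by
    intro x y W hx hy
    have := congrArg (A.rest (le_inf hx hy)) (hc x y)
    rwa [rest_unitVal_smul, rest_rest, rest_rest] at this
  obtain ⟨t, ht⟩ := X.exists_germs_coboundary U hU c fun x y z W hx hy hz => by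
    refine unitVal_injective (((hs z).rest hz).smul_injective ?_)
    refine Eq.trans ?_ (hc' x z W hx hz)
    rw [hc' x y W hx hy, hc' y z W hy hz]
    exact mul_smul (unitVal _) (unitVal _) _
  -- On overlaps the `t x` differ by the units `c x y`, so their images in the quotient agree.
  obtain ⟨q, hq⟩ := X.germsQuot.exists_gluing U ⊤ (fun _ => le_top) (fun x _ => ⟨x, hU x⟩)
    (fun x => X.toQuot _ (t x)) (fun x y => by
      rw [← toQuot_rest, ← toQuot_rest, ← sub_eq_zero, ← map_sub, ← ht, toQuot_toGerms])
  refine ⟨q, U, t, s, hU, fun x => (hq x).symm, hs, fun x y W hx hy u hu => ?_⟩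
  rw [hc' x y W hx hy]
  congr 2
  apply X.toGerms_injective
  rw [hu, toGerms_rest, ht, map_sub, AbSheaf.rest_rest, AbSheaf.rest_rest]

end OSetPresheaf

open MonoidalSpace

variable {X : MonoidalSpace.{u}}

/-! ## The invertible sheaf of a class -/

/-- A section over `V` of the invertible sheaf with class `q`: the family of its coordinates with
respect to the local lifts of `q`. -/
@[ext]
structure TwistedSec (q : X.germsQuot.Sec ⊤) (V : Opens X.space) : Type u where
  /-- the coordinate of the section with respect to a lift -/
  coord : ∀ W : Opens X.space, W ≤ V → ∀ t : X.germs.Sec W, IsLift q t → X.Sec W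
  res_coord : ∀ (W Z : Opens X.space) (hW : W ≤ V) (h : Z ≤ W) (t : X.germs.Sec W)
    (ht : IsLift q t), X.res (homOfLE h) (coord W hW t ht) =
      coord Z (h.trans hW) (X.germs.rest h t) (ht.rest h)
  -- Coordinates transform inversely to generators: the generators attached to `t` and `t'` are to
  -- satisfy `s_{t'} = u • s_t`.
  coord_change : ∀ (W : Opens X.space) (hW : W ≤ V) (t t' : X.germs.Sec W) (ht : IsLift q t)
    (ht' : IsLift q t') (u : X.units.Sec W), X.toGerms W u = t' - t →
      coord W hW t ht = unitVal u * coord W hW t' ht'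

namespace TwistedSec

variable {q : X.germsQuot.Sec ⊤} {V : Opens X.space}

/-- Restriction to a smaller open subset. -/
def rest {W : Opens X.space} (h : W ≤ V) (f : TwistedSec q V) : TwistedSec q W where
  coord Z hZ := f.coord Z (hZ.trans h)
  res_coord Z Z' hZ := f.res_coord Z Z' (hZ.trans h)
  coord_change Z hZ := f.coord_change Z (hZ.trans h)

instance : MulAction (X.Sec V) (TwistedSec q V) where
  smul a f :=
    { coord := fun W hW t ht => X.res (homOfLE hW) a * f.coord W hW t ht
      res_coord := fun W Z hW h t ht => by rw [_root_.map_mul, X.res_res, f.res_coord]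
      coord_change := fun W hW t t' ht ht' u hu => by
        rw [f.coord_change W hW t t' ht ht' u hu, mul_left_comm] }
  one_smul f := by
    ext W hW t ht
    change X.res (homOfLE hW) 1 * f.coord W hW t ht = _
    rw [_root_.map_one, one_mul]
  mul_smul a b f := by
    ext W hW t ht
    change X.res (homOfLE hW) (a * b) * f.coord W hW t ht = _ * (_ * _)
    rw [_root_.map_mul, mul_assoc]

lemma smul_coord (a : X.Sec V) (f : TwistedSec q V) {W : Opens X.space} (hW : W ≤ V)
    (t : X.germs.Sec W) (ht : IsLift q t) :
    (a • f).coord W hW t ht = X.res (homOfLE hW) a * f.coord W hW t ht := rfl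

end TwistedSec

/-- The presheaf of `𝒪_X`-sets with class `q`. -/
def twistedPresheaf (q : X.germsQuot.Sec ⊤) : OSetPresheaf X where
  presheaf :=
    { obj := fun V => TwistedSec q V.unop
      map := fun i => ↾(TwistedSec.rest i.unop.le) }
  act := fun V => (inferInstance : MulAction (X.Sec V) (TwistedSec q V))
  map_smul := fun {U V} i a f => TwistedSec.ext <| by
    funext W hW t ht
    change X.res _ a * f.coord W _ t ht = X.res _ (X.res i a) * f.coord W _ t ht
    rw [X.res_res]

/-- For each lift over `W`, the coordinates of the given sections on the sets `W ⊓ U i` glue in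
`𝒪_X`. The compatibility axioms and uniqueness are equalities in `𝒪_X`, hence local. -/
lemma isSheaf_twistedPresheaf (q : X.germsQuot.Sec ⊤) : (twistedPresheaf q).presheaf.IsSheaf := by
  have hO := OSetPresheaf.isInvertible_structureOSet X
  refine TopCat.Presheaf.isSheaf_of_isSheafUniqueGluing_types _ fun ι U f hf => ?_
  change ∀ i, TwistedSec q (U i) at f
  have hf' : ∀ i j (W : Opens X.space) (hi : W ≤ U i) (hj : W ≤ U j) (t : X.germs.Sec W)
      (ht : IsLift q t), (f i).coord W hi t ht = (f j).coord W hj t ht := fun i j W hi hj t ht =>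
    congrArg (fun g : TwistedSec q (U i ⊓ U j) => g.coord W (le_inf hi hj) t ht) (hf i j)
  have hex : ∀ (W : Opens X.space) (_ : W ≤ iSup U) (t : X.germs.Sec W) (ht : IsLift q t),
      ∃ a : X.Sec W, ∀ i, X.res (homOfLE inf_le_left) a =
        (f i).coord (W ⊓ U i) inf_le_right (X.germs.rest inf_le_left t) (ht.rest _) := by
    intro W hW t ht
    refine hO.exists_gluing (fun i => W ⊓ U i) W (fun _ => inf_le_left)
      (fun x hx => ?_) (fun i => (f i).coord (W ⊓ U i) inf_le_right
        (X.germs.rest inf_le_left t) (ht.rest _)) fun i j => ?_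
    · obtain ⟨i, hi⟩ := Opens.mem_iSup.1 (hW hx)
      exact ⟨i, hx, hi⟩
    · refine ((f i).res_coord _ _ _ _ _ _).trans (Eq.trans ?_ ((f j).res_coord _ _ _ _ _ _).symm)
      simp only [AbSheaf.rest_rest]
      exact hf' i j _ _ _ _ _
  choose c hc using hex
  have hc' : ∀ (W : Opens X.space) (hW : W ≤ iSup U) (t : X.germs.Sec W) (ht : IsLift q t) (i : ι)
      (Z : Opens X.space) (h : Z ≤ W) (hZ : Z ≤ U i), X.res (homOfLE h) (c W hW t ht) =
        (f i).coord Z hZ (X.germs.rest h t) (ht.rest _) := by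
    intro W hW t ht i Z h hZ
    have := congrArg (X.res (homOfLE (le_inf h hZ))) (hc W hW t ht i)
    rw [X.res_res _ _ (homOfLE h), (f i).res_coord] at this
    simpa only [AbSheaf.rest_rest] using this
  have hext : ∀ (W : Opens X.space) (_ : W ≤ iSup U) (a b : X.Sec W),
      (∀ i (Z : Opens X.space) (h : Z ≤ W) (_ : Z ≤ U i),
        X.res (homOfLE h) a = X.res (homOfLE h) b) → a = b := by
    intro W hW a b hab
    refine hO.eq_of_locally_eq a b fun x hx => ?_
    obtain ⟨i, hi⟩ := Opens.mem_iSup.1 (hW hx)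
    exact ⟨W ⊓ U i, inf_le_left, ⟨hx, hi⟩, hab i _ _ inf_le_right⟩
  refine ⟨(⟨c, fun W Z hW h t ht => ?_, fun W hW t t' ht ht' u hu => ?_⟩ : TwistedSec q (iSup U)),
    fun i => TwistedSec.ext ?_, fun g hg => TwistedSec.ext ?_⟩
  · refine hext Z (h.trans hW) _ _ fun i Z' h' hi => ?_
    rw [X.res_res _ _ (homOfLE (h'.trans h)), hc' _ _ _ _ i _ _ hi, hc' _ _ _ _ i _ _ hi]
    simp only [AbSheaf.rest_rest]
  · refine hext W hW _ _ fun i Z h hi => ?_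
    rw [_root_.map_mul, hc' _ _ _ _ i _ _ hi, hc' _ _ _ _ i _ _ hi]
    refine (f i).coord_change Z hi _ _ _ _ (X.units.rest h u) ?_
    rw [toGerms_rest, hu, map_sub]
  · funext W hW t ht
    change c W _ t ht = (f i).coord W hW t ht
    have := hc' W (hW.trans (le_iSup U i)) t ht i W le_rfl hW
    rw [X.res_id] at this
    simpa only [AbSheaf.rest_self] using this
  · change TwistedSec q (iSup U) at g
    funext W hW t ht
    refine hext W hW _ _ fun i Z h hi => ?_
    refine (g.res_coord W Z hW h t ht).trans (Eq.trans ?_ (hc' W hW t ht i Z h hi).symm)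
    exact congrArg (fun g : TwistedSec q (U i) => g.coord Z hi _ (ht.rest h)) (hg i)

namespace MonoidalSpace.IsLift

variable {q : X.germsQuot.Sec ⊤} {V : Opens X.space} {t : X.germs.Sec V}

/-- The section whose coordinate with respect to the lift `t` is `1`. -/
def twistedSec (ht : IsLift q t) : TwistedSec q V where
  -- The coordinate at `t'` is the unit with image `t - t'`; since this unit is unique, choosing it
  -- is compatible with restriction.
  coord W hW t' ht' := unitVal ((ht.rest hW).exists_unit ht').choose
  res_coord W Z hW h t' ht' := by
    rw [← unitVal_rest]
    congr 1
    apply X.toGerms_injective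
    rw [toGerms_rest, ((ht.rest hW).exists_unit ht').choose_spec,
      ((ht.rest (h.trans hW)).exists_unit (ht'.rest h)).choose_spec, map_sub, AbSheaf.rest_rest]
  coord_change W hW t₁ t₂ ht₁ ht₂ u hu := by
    rw [← unitVal_add]
    congr 1
    apply X.toGerms_injective
    rw [map_add, hu, ((ht.rest hW).exists_unit ht₁).choose_spec,
      ((ht.rest hW).exists_unit ht₂).choose_spec]
    abel

lemma twistedSec_coord (ht : IsLift q t) {W : Opens X.space} (hW : W ≤ V) {t' : X.germs.Sec W}
    (ht' : IsLift q t') (u : X.units.Sec W) (hu : X.toGerms W u = X.germs.rest hW t - t') :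
    ht.twistedSec.coord W hW t' ht' = unitVal u := by
  refine congrArg unitVal (X.toGerms_injective W ?_)
  rw [((ht.rest hW).exists_unit ht').choose_spec, hu]

lemma twistedSec_coord_self (ht : IsLift q t) {W : Opens X.space} (hW : W ≤ V) :
    ht.twistedSec.coord W hW (X.germs.rest hW t) (ht.rest hW) = 1 := by
  rw [ht.twistedSec_coord hW (ht.rest hW) 0 (by rw [_root_.map_zero, sub_self]), unitVal_zero]

/-- By `coord_change` and `res_coord`, a section over `W ≤ V` is determined by its coordinate at `t`
restricted to `W`, which can be any element of `𝒪_X(W)`; the multiple by `a` of this section has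
coordinate `a` there. -/
lemma isGenerator_twistedSec (ht : IsLift q t) :
    OSetPresheaf.IsGenerator (A := twistedPresheaf q) (V := V) ht.twistedSec := by
  intro W hW
  have coord_self : ∀ a : X.Sec W, (a • ht.twistedSec.rest hW).coord W le_rfl
      (X.germs.rest hW t) (ht.rest hW) = a := fun a => by
    rw [TwistedSec.smul_coord, X.res_id]
    exact (congrArg (a * ·) (ht.twistedSec_coord_self hW)).trans (mul_one a)
  refine ⟨fun a b hab => ?_, fun f => ?_⟩
  · rw [← coord_self a, ← coord_self b]
    exact congrArg (fun g : TwistedSec q W => g.coord W le_rfl (X.germs.rest hW t) (ht.rest hW)) hab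
  · change TwistedSec q W at f
    refine ⟨f.coord W le_rfl _ (ht.rest hW), TwistedSec.ext ?_⟩
    funext Z hZ t' ht'
    obtain ⟨u, hu⟩ := (ht.rest (hZ.trans hW)).exists_unit ht'
    rw [f.coord_change Z hZ t' _ ht' (ht.rest (hZ.trans hW)) u hu, mul_comm]
    change X.res _ (f.coord W _ _ _) * ht.twistedSec.coord Z _ t' ht' = _
    rw [ht.twistedSec_coord _ ht' u hu, f.res_coord]
    simp only [AbSheaf.rest_rest]

end MonoidalSpace.IsLift

lemma isInvertible_twistedPresheaf (q : X.germsQuot.Sec ⊤) : (twistedPresheaf q).IsInvertible where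
  isSheaf := isSheaf_twistedPresheaf q
  locally_trivial x := by
    obtain ⟨V, t, hx, ht⟩ := exists_isLift q x
    exact ⟨V, hx, ⟨(ht.isGenerator_twistedSec.isoOn).symm⟩⟩

/-- The generators are those attached to chosen local lifts. Their transition functions come from
splitting `t x - t'` as `(t x - t y) + (t y - t')` for an arbitrary lift `t'`. -/
lemma hasClass_twistedPresheaf (q : X.germsQuot.Sec ⊤) : (twistedPresheaf q).HasClass q := by
  choose U t hU ht using exists_isLift q
  refine ⟨U, t, fun x => (ht x).twistedSec, hU, ht, fun x => (ht x).isGenerator_twistedSec,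
    fun x y W hx hy u hu => TwistedSec.ext ?_⟩
  funext Z hZ t' ht'
  obtain ⟨v, hv⟩ := ((ht y).rest (hZ.trans hy)).exists_unit ht'
  refine ((ht x).twistedSec_coord (hZ.trans hx) ht' (X.units.rest hZ u + v) ?_).trans ?_
  · rw [map_add, toGerms_rest, hu, hv, map_sub, AbSheaf.rest_rest, AbSheaf.rest_rest]
    abel
  · exact congrArg (X.res (homOfLE hZ) (unitVal u) * ·)
      ((ht y).twistedSec_coord (hZ.trans hy) ht' v hv).symm

/-! ## The Picard group as a cohomology group -/

/-- The surjections `L` and `δ` have the same fibres and respect the operations, so `P` and `H` are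
the same quotient of `Q`. Only a multiplication on `P` is assumed, so the group axioms for `Pic`
need no separate proof: they are transported from `H`. -/
lemma nonempty_mulEquiv_of_surjective {P Q H : Type*} [Mul P] [AddGroup Q] [AddGroup H]
    (L : Q → P) (hL : Function.Surjective L) (hL_mul : ∀ a b, L (a + b) = L a * L b)
    (δ : Q →+ H) (hδ : Function.Surjective δ) (h : ∀ a b, L a = L b ↔ δ (a - b) = 0) :
    Nonempty (P ≃* Multiplicative H) := by
  have h' : ∀ a b, L a = L b ↔ δ a = δ b := fun a b => by rw [h, map_sub, sub_eq_zero]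
  have hf : ∀ a, δ (Function.surjInv hL (L a)) = δ a := fun a =>
    (h' _ _).1 (Function.surjInv_eq hL _)
  let f : P →ₙ* Multiplicative H :=
    { toFun := fun p => Multiplicative.ofAdd (δ (Function.surjInv hL p))
      map_mul' := fun p p' => by
        obtain ⟨a, rfl⟩ := hL p
        obtain ⟨b, rfl⟩ := hL p'
        rw [← hL_mul, hf, hf, hf, map_add, ofAdd_add] }
  refine ⟨MulEquiv.ofBijective f ⟨fun p p' hp => ?_, fun y => ?_⟩⟩
  · rw [← Function.surjInv_eq hL p, ← Function.surjInv_eq hL p', h']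
    exact hp
  · obtain ⟨a, ha⟩ := hδ y.toAdd
    exact ⟨L a, congrArg Multiplicative.ofAdd ((hf a).trans ha)⟩

variable (X) in
/-- The Picard group of a monoidal space is the first cohomology group of the sheaf of units. -/
theorem nonempty_pic_mulEquiv : Nonempty (Pic X ≃* Multiplicative (Sheaf.H X.units 1)) := by
  have := X.units.isFlasque_godement
  obtain ⟨δ, hδ, hδ_ker⟩ : ∃ δ : X.germsQuot.Sec ⊤ →+ Sheaf.H X.units 1,
      Function.Surjective δ ∧ ∀ q, δ q = 0 ↔ ∃ a, X.toQuot ⊤ a = q :=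
    AbSheaf.exists_connecting X.units.shortExact_godementSequence
      (AbSheaf.H_one_eq_zero_of_isFlasque X.units.godement)
  let L : X.germsQuot.Sec ⊤ → Pic X := fun q => ⟦⟨_, isInvertible_twistedPresheaf q⟩⟧
  -- The class modulo the image of the global sections of `germs`, which is the kernel of `δ`, is a
  -- complete isomorphism invariant.
  have key : ∀ {A B : InvertibleSheaf X} {q r : X.germsQuot.Sec ⊤}, A.1.HasClass q →
      B.1.HasClass r → ((⟦A⟧ : Pic X) = ⟦B⟧ ↔ δ (q - r) = 0) := by
    intro A B q r hA hB
    refine Quotient.eq.trans ((?_ : _ ↔ ∃ a, X.toQuot ⊤ a = q - r).trans (hδ_ker (q - r)).symm)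
    exact ⟨fun ⟨e⟩ => hA.exists_of_isoOn hB e, fun ⟨a, ha⟩ => hA.nonempty_isoOn A.2 B.2 hB a ha⟩
  have hL : ∀ q : X.germsQuot.Sec ⊤, (twistedPresheaf q).HasClass q := hasClass_twistedPresheaf
  refine nonempty_mulEquiv_of_surjective L ?_ ?_ δ hδ fun q r => key (hL q) (hL r)
  · rintro ⟨A⟩
    obtain ⟨q, hq⟩ := A.2.exists_hasClass
    exact ⟨q, (key (hL q) hq).2 (by rw [sub_self, _root_.map_zero])⟩
  · intro q r
    -- The sheaf built from `q + r` and the tensor product of those built from `q` and `r` both have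
    -- class `q + r`.
    exact (key (A := ⟨_, isInvertible_twistedPresheaf _⟩)
      (B := ⟨_, (isInvertible_twistedPresheaf q).tensor (isInvertible_twistedPresheaf r)⟩)
      (hL (q + r)) ((hL q).tensor (hL r))).2 (by rw [sub_self, _root_.map_zero])

end

theorem proposition3p15 (X : MonoidScheme.{u}) [IrreducibleSpace X.space]
    (K : Type u) [Semifield K] :
    Nonempty (Pic X.toMonoidalSpace ≃*
      Multiplicative (Sheaf.H
        (Limits.prod (constantSheafOf X.space Kˣ) X.toMonoidalSpace.unitsSheaf) 1)) := by
  let F : AbSheaf X.space := constantSheafOf X.space Kˣ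
  have : TopCat.Sheaf.IsFlasque F :=
    AbSheaf.isFlasque_constantSheaf (AddCommGrpCat.of (Additive Kˣ))
  obtain ⟨e⟩ := nonempty_pic_mulEquiv X.toMonoidalSpace
  exact ⟨e.trans (AbSheaf.HOneProdEquiv F X.units
    (AbSheaf.H_one_eq_zero_of_isFlasque F)).symm.toMultiplicative⟩
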